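/- Let $K$ be an algebraically closed field, let $n\ge 1$, and let $G$ be $SO_{2n+1}(K)$ (type $B_n$) or $Sp_{2n}(K)$ (type $C_n$), with $T$ the diagonal torus, $B\supset T$ the triangular Borel subgroup and $B^-$ its opposite. Number the simple roots so that $\alpha_1$ is the special node: $\alpha_i=\varepsilon_i-\varepsilon_{i-1}$ for $2\le i\le n$, and $\alpha_1=\varepsilon_1$ in type $B$, $\alpha_1=2\varepsilon_1$ in type $C$. Let $W$ be the Weyl group (the signed permutations of $\{\pm1,\dots,\pm n\}$) with its Bruhat order $\le$, $\omega_r$ the $r$-th fundamental weight, $P_r$ the maximal parabolic subgroup generated by $B$ and representatives of the simple reflections $s_i$, $i\ne r$, and $W^{I_r}=\{w\in W: w(\alpha_i)>0 \text{ for all } i\neq r\}$. For a weight $\lambda$ write $\lambda\ge 0$ if $\lambda$ is a nonnegative real combination of simple roots, and $\lambda\le 0$ if $-\lambda\ge 0$. For $v,w\in W^{I_r}$ let $X_w^v=\overline{BwP_r/P_r}\cap\overline{B^-vP_r/P_r}\subseteq G/P_r$ (Zariski closures). Let $J_{m,[s,t]}$ be the set of tuples $(i_1,\dots,i_m)$ of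 integers in $[s,t]$ with $i_{k+1}-i_k\ge 2$ for all $k$. (i) Let $2\le r\le n-1$. If $n+1-r=2m$ and $\underline i,\underline j\in J_{m,[2,n]}$, let $v_{\underline i},w_{\underline j}\in W^{I_r}$ be the elements with $v_{\underline i}(\omega_r)=\sum_{k=1}^m\alpha_{i_k}$ and $w_{\underline j}(\omega_r)=-\sum_{k=1}^m\alpha_{j_k}$. If $n+1-r=2m+1$ and $\underline i,\underline j\in J_{m,[3,n]}$, let $v_{\underline i},w_{\underline j}\in W^{I_r}$ be the elements with $v_{\underline i}(\omega_r)=c\,\alpha_1+\sum_{k=1}^m\alpha_{i_k}$ and $w_{\underline j}(\omega_r)=-\bigl(c\,\alpha_1+\sum_{k=1}^m\alpha_{j_k}\bigr)$, where $c=1$ in type $B$ and $c=\tfrac12$ in type $C$. In both cases $X^{v_{\underline i}}_{w_{\underline j}}$ is nonempty if and only if $|i_k-j_k|\le 1$ for all $1\le k\le m$; and likewise $v_{\underline i}\le w_{\underline j}$ in the Bruhat order if and only if $|i_k-j_k|\le 1$ for all $1\le k\le m$. (ii) Let $r=1$ or $r=n$. If $v$ is maximal (in the Bruhat order) among the elements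 of $W^{I_r}$ with $v(\omega_r)\ge 0$, and $w$ is minimal among the elements of $W^{I_r}$ with $w(\omega_r)\le 0$, then $X_w^v$ is nonempty and $v\le w$. -/

import Mathlib

open scoped Topology

noncomputable section

namespace RichardsonBC

/-- The two families of root systems `B_n` and `C_n`. -/
inductive DynkinType : Type
  | B : DynkinType
  | C : DynkinType

/-! ### The Weyl group of type `B_n` / `C_n` and its Bruhat order -/

/-- The Weyl group `W` of type `B_n` or `C_n`: the group of signed permutations of `[-n, n]`,
realised as the permutations `σ` of `ℤ` with `σ (-a) = -σ a` that fix all `a` with `|a| > n`.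
The window of `σ` is `(σ 1, …, σ n)`. -/
def weylGroup (n : ℕ) : Subgroup (Equiv.Perm ℤ) where
  carrier := {σ | (∀ a, σ (-a) = -σ a) ∧ ∀ a : ℤ, (n : ℤ) < |a| → σ a = a}
  mul_mem' := by
    rintro σ τ ⟨h1, h2⟩ ⟨h3, h4⟩
    refine ⟨fun a => ?_, fun a ha => ?_⟩
    · simp [Equiv.Perm.mul_apply, h1, h3]
    · simp [Equiv.Perm.mul_apply, h4 a ha, h2 a ha]
  one_mem' := by simp
  inv_mem' := by
    rintro σ ⟨h1, h2⟩
    refine ⟨fun a => ?_, fun a ha => ?_⟩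
    · rw [Equiv.Perm.inv_eq_iff_eq, h1]; simp
    · rw [Equiv.Perm.inv_eq_iff_eq, h2 a ha]

/-- The simple reflections `s_1 = (1, -1)` and `s_i = (i-1, i)(-(i-1), -i)` for `2 ≤ i ≤ n`
(the node `1` is the special node of the Dynkin diagram). -/
def simpleReflection (i : ℕ) : Equiv.Perm ℤ :=
  if i = 1 then Equiv.swap 1 (-1)
  else Equiv.swap ((i : ℤ) - 1) i * Equiv.swap (-((i : ℤ) - 1)) (-(i : ℤ))

/-- The Coxeter length: the least length of a word in `s_1, …, s_n` with product `w`. -/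
def length (n : ℕ) (w : Equiv.Perm ℤ) : ℕ :=
  sInf {k | ∃ l : List ℕ, l.length = k ∧ (∀ i ∈ l, 1 ≤ i ∧ i ≤ n) ∧
    (l.map simpleReflection).prod = w}

/-- The reflections of `W`: the conjugates of the simple reflections. -/
def IsReflection (n : ℕ) (τ : Equiv.Perm ℤ) : Prop :=
  ∃ g ∈ weylGroup n, ∃ i : ℕ, 1 ≤ i ∧ i ≤ n ∧ τ = g * simpleReflection i * g⁻¹

/-- The Bruhat order on `W`: the reflexive-transitive closure of `u → τ u`, for reflections `τ`
with `ℓ(u) < ℓ(τ u)`. -/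
def BruhatLE (n : ℕ) : Equiv.Perm ℤ → Equiv.Perm ℤ → Prop :=
  Relation.ReflTransGen fun u u' =>
    ∃ τ, IsReflection n τ ∧ u' = τ * u ∧ length n u < length n u'

/-! ### Roots and weights

The space `X(T) ⊗ ℝ` is realised inside the functions `x : ℤ → ℝ` as the span of the vectors `ε k`,
`1 ≤ k ≤ n`, where `ε (-k) = -ε k`; a signed permutation `w` maps `ε k` to `ε (w k)`. -/

/-- The coordinate vector `ε k`, with `ε (-k) = -ε k`. -/
def ε (k : ℤ) : ℤ → ℝ := fun a => (if a = k then 1 else 0) - (if a = -k then 1 else 0)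

/-- The action of the Weyl group on weights; `act w (ε k) = ε (w k)`. -/
def act (w : Equiv.Perm ℤ) (x : ℤ → ℝ) : ℤ → ℝ := fun a => x (w⁻¹ a)

/-- The simple roots: `α_i = ε_i - ε_{i-1}` for `2 ≤ i ≤ n`, and `α_1 = ε_1` in type `B`,
`α_1 = 2 ε_1` in type `C`. -/
def simpleRoot (t : DynkinType) (i : ℕ) : ℤ → ℝ :=
  if i = 1 then
    match t with
    | .B => ε 1
    | .C => (2 : ℝ) • ε 1
  else ε i - ε ((i : ℤ) - 1)

/-- The fundamental weights: `ω_r = ε_r + ⋯ + ε_n`, except that `ω_1 = (ε_1 + ⋯ + ε_n) / 2` in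
type `B`. -/
def fundamentalWeight (t : DynkinType) (n r : ℕ) : ℤ → ℝ :=
  match t with
  | .B => (if r = 1 then (1 / 2 : ℝ) else 1) • ∑ k ∈ Finset.Icc r n, ε k
  | .C => ∑ k ∈ Finset.Icc r n, ε k

/-- `x ≥ 0`: `x` is a nonnegative real combination of the simple roots. -/
def Nonneg (t : DynkinType) (n : ℕ) (x : ℤ → ℝ) : Prop :=
  ∃ c : ℕ → ℝ, (∀ i, 0 ≤ c i) ∧ x = ∑ i ∈ Finset.Icc 1 n, c i • simpleRoot t i

/-- The positive roots: the roots (the images of simple roots under `W`) that are `≥ 0`. -/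
def positiveRoots (t : DynkinType) (n : ℕ) : Set (ℤ → ℝ) :=
  {β | (∃ u ∈ weylGroup n, ∃ i : ℕ, 1 ≤ i ∧ i ≤ n ∧ β = act u (simpleRoot t i)) ∧ Nonneg t n β}

/-- `W^{I_r}`, `I_r = {α_r}`: the `w ∈ W` with `w(α_i) > 0` for all simple roots `α_i ≠ α_r`. -/
def minimalReps (t : DynkinType) (n r : ℕ) : Set (Equiv.Perm ℤ) :=
  {w | w ∈ weylGroup n ∧
    ∀ i : ℕ, 1 ≤ i → i ≤ n → i ≠ r → act w (simpleRoot t i) ∈ positiveRoots t n}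

/-- `v` is maximal (for the Bruhat order) among the `v ∈ W^{I_r}` with `v(ω_r) ≥ 0`. -/
def IsMaximalNonneg (t : DynkinType) (n r : ℕ) (v : Equiv.Perm ℤ) : Prop :=
  v ∈ minimalReps t n r ∧ Nonneg t n (act v (fundamentalWeight t n r)) ∧
    ∀ u ∈ minimalReps t n r, Nonneg t n (act u (fundamentalWeight t n r)) →
      BruhatLE n v u → u = v

/-- `w` is minimal (for the Bruhat order) among the `w ∈ W^{I_r}` with `w(ω_r) ≤ 0`. -/
def IsMinimalNonpos (t : DynkinType) (n r : ℕ) (w : Equiv.Perm ℤ) : Prop :=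
  w ∈ minimalReps t n r ∧ Nonneg t n (-act w (fundamentalWeight t n r)) ∧
    ∀ u ∈ minimalReps t n r, Nonneg t n (-act u (fundamentalWeight t n r)) →
      BruhatLE n u w → u = w

/-- `J_{p,[s,t]}`: the tuples `(i_1, …, i_p)` in `[s, t]` with `i_{k+1} - i_k ≥ 2`. -/
def J (p s t : ℕ) : Set (Fin p → ℕ) :=
  {i | (∀ k, s ≤ i k ∧ i k ≤ t) ∧ ∀ k l : Fin p, (l : ℕ) = k + 1 → i k + 2 ≤ i l}

/-- `ε_1` as a multiple of `α_1`: it is `α_1` in type `B` and `α_1 / 2` in type `C`. -/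
def oddPart (t : DynkinType) : ℤ → ℝ :=
  match t with
  | .B => simpleRoot .B 1
  | .C => (1 / 2 : ℝ) • simpleRoot .C 1

/-! ### The algebraic groups and their Richardson varieties -/

/-- The index set of the standard basis of the natural representation: `[-n, n]` in type `B`, and
`[-n, n]` without `0` in type `C`. -/
def Idx (t : DynkinType) (n : ℕ) : Type :=
  {k : ℤ // k ∈ Finset.Icc (-(n : ℤ)) n ∧ (t = .C → k ≠ 0)}

instance (t : DynkinType) (n : ℕ) : CoeOut (Idx t n) ℤ := ⟨Subtype.val⟩

instance (t : DynkinType) (n : ℕ) : DecidableEq (Idx t n) :=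
  inferInstanceAs (DecidableEq {k : ℤ // k ∈ Finset.Icc (-(n : ℤ)) n ∧ (t = .C → k ≠ 0)})

instance (t : DynkinType) (n : ℕ) : Fintype (Idx t n) :=
  Fintype.ofInjective (β := Finset.Icc (-(n : ℤ)) n) (fun a => ⟨a.1, a.2.1⟩)
    (fun _ _ h => Subtype.ext (by simpa using h))

/-- The quadratic form `x_0 ^ 2 + ∑_{k = 1}^n x_k x_{-k}` (used in type `B`). -/
def quadForm {K : Type*} [Field K] {t : DynkinType} {n : ℕ} (x : Idx t n → K) : K :=
  ∑ a : Idx t n, ∑ b : Idx t n, if (a : ℤ) + b = 0 ∧ 0 ≤ (a : ℤ) then x a * x b else 0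

/-- The symplectic form `∑_{k = 1}^n (x_k y_{-k} - x_{-k} y_k)` (used in type `C`). -/
def sympForm {K : Type*} [Field K] {t : DynkinType} {n : ℕ} (x y : Idx t n → K) : K :=
  ∑ a : Idx t n, ∑ b : Idx t n,
    if (a : ℤ) + b = 0 then ((Int.sign (a : ℤ) : ℤ) : K) * (x a * y b) else 0

/-- The defining condition of `SO_{2n+1}` (type `B`) and `Sp_{2n}` (type `C`). -/
def PreservesForm {K : Type*} [Field K] {n : ℕ} :
    (t : DynkinType) → Matrix (Idx t n) (Idx t n) K → Prop
  | .B, g => (∀ x, quadForm (g.mulVec x) = quadForm x) ∧ g.det = 1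
  | .C, g => ∀ x y, sympForm (g.mulVec x) (g.mulVec y) = sympForm x y

/-- The algebraic group `G` (its group of `K`-points): `SO_{2n+1}(K)` in type `B_n` and
`Sp_{2n}(K)` in type `C_n`. -/
def algGroup (K : Type*) [Field K] (t : DynkinType) (n : ℕ) : Subgroup (GL (Idx t n) K) where
  carrier := {g | PreservesForm t (g : Matrix (Idx t n) (Idx t n) K)}
  mul_mem' := by
    intro g h hg hh
    cases t with
    | B =>
      refine ⟨fun x => ?_, ?_⟩
      · rw [Units.val_mul, ← Matrix.mulVec_mulVec, hg.1, hh.1]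
      · rw [Units.val_mul, Matrix.det_mul, hg.2, hh.2, one_mul]
    | C =>
      intro x y
      rw [Units.val_mul, ← Matrix.mulVec_mulVec, ← Matrix.mulVec_mulVec, hg, hh]
  one_mem' := by
    cases t with
    | B => exact ⟨fun x => by simp, by simp⟩
    | C => intro x y; simp
  inv_mem' := by
    intro g hg
    have key : ∀ x, (g : Matrix (Idx t n) (Idx t n) K).mulVec
        ((↑g⁻¹ : Matrix (Idx t n) (Idx t n) K).mulVec x) = x := by
      intro x
      rw [Matrix.mulVec_mulVec, ← Units.val_mul, mul_inv_cancel, Units.val_one,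
        Matrix.one_mulVec]
    cases t with
    | B =>
      refine ⟨fun x => ?_, ?_⟩
      · rw [← hg.1, key]
      · have h1 : (g : Matrix (Idx .B n) (Idx .B n) K).det *
            (↑g⁻¹ : Matrix (Idx .B n) (Idx .B n) K).det = 1 := by
          rw [← Matrix.det_mul, ← Units.val_mul, mul_inv_cancel, Units.val_one, Matrix.det_one]
        rwa [hg.2, one_mul] at h1
    | C =>
      intro x y
      rw [← hg, key, key]

section Group

variable (K : Type*) [Field K] (t : DynkinType) (n : ℕ)

/-- The matrix entry `g_{a b}` of `g ∈ G`. -/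
def entry {K : Type*} [Field K] {t : DynkinType} {n : ℕ} (g : algGroup K t n)
    (a b : Idx t n) : K :=
  (g : GL (Idx t n) K).1 a b

/-- The Borel subgroup `B` for the positive roots: the triangular matrices in `G` whose entries
`g_{a b}` vanish unless `a ≥ b`. (The diagonal torus `T` acts on the `(a, b)` entry of the Lie
algebra with weight `ε_a - ε_b`.) -/
def borel : Set (algGroup K t n) := {g | ∀ a b, entry g a b ≠ 0 → (b : ℤ) ≤ a}

/-- The opposite Borel subgroup `B⁻`. -/
def oppBorel : Set (algGroup K t n) := {g | ∀ a b, entry g a b ≠ 0 → (a : ℤ) ≤ b}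

/-- The representatives in `N_G(T)` of the signed permutation `w`: the monomial matrices in `G`
that map the line of the `b`-th basis vector to that of the `w(b)`-th one. -/
def representatives (w : Equiv.Perm ℤ) : Set (algGroup K t n) :=
  {g | ∀ a b, entry g a b ≠ 0 ↔ (a : ℤ) = w b}

/-- The maximal parabolic subgroup `P_r`, generated by `B` and representatives of the simple
reflections `s_i` with `i ≠ r`. -/
def parabolic (r : ℕ) : Subgroup (algGroup K t n) :=
  Subgroup.closure (borel K t n ∪
    {g | ∃ i : ℕ, 1 ≤ i ∧ i ≤ n ∧ i ≠ r ∧ g ∈ representatives K t n (simpleReflection i)})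

/-- The Zariski topology on `G`: a set is closed if it is the set of common zeros in `G` of some
polynomials in the matrix entries. -/
abbrev zariskiTopology : TopologicalSpace (algGroup K t n) :=
  TopologicalSpace.induced
    (fun g => MvPolynomial.pointToPoint (k := K) (K := K) (fun p : Idx t n × Idx t n => entry g p.1 p.2))
    inferInstance

/-- The Zariski topology on `G / P_r`, which is the quotient topology. -/
abbrev flagTopology (r : ℕ) : TopologicalSpace (algGroup K t n ⧸ parabolic K t n r) :=
  TopologicalSpace.coinduced QuotientGroup.mk (zariskiTopology K t n)

/-- The Schubert variety `X_w`, the closure of `B w P_r / P_r` in `G / P_r`. -/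
def schubertVariety (r : ℕ) (w : Equiv.Perm ℤ) : Set (algGroup K t n ⧸ parabolic K t n r) :=
  closure[flagTopology K t n r]
    {x | ∃ b ∈ borel K t n, ∃ g ∈ representatives K t n w, x = QuotientGroup.mk (b * g)}

/-- The opposite Schubert variety `X^v`, the closure of `B⁻ v P_r / P_r` in `G / P_r`. -/
def oppSchubertVariety (r : ℕ) (v : Equiv.Perm ℤ) :
    Set (algGroup K t n ⧸ parabolic K t n r) :=
  closure[flagTopology K t n r]
    {x | ∃ b ∈ oppBorel K t n, ∃ g ∈ representatives K t n v, x = QuotientGroup.mk (b * g)}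

/-- The Richardson variety `X_w^v` in `G / P_r`, the intersection of `X_w` and `X^v`. -/
def richardsonVariety (r : ℕ) (v w : Equiv.Perm ℤ) :
    Set (algGroup K t n ⧸ parabolic K t n r) :=
  schubertVariety K t n r w ∩ oppSchubertVariety K t n r v

end Group

end RichardsonBC

end

open RichardsonBC

/-!
A coset in `W / W_{P_r}` is recorded by the set of values `{w r, …, w n}`, and sets of values are
compared by counting their letters `≥ c`, for every `c`. A point of `X_w^v` has a nonzero minor on
the columns `r, …, n`. Minors are closed conditions, and for points of `B w P_r` (of `B⁻ v P_r`) a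
minor vanishes unless its set of rows lies above the values of `w` (below the values of `v`). So if
`X_w^v` is nonempty, the values of `w` lie below those of `v`.

Conversely, if the values of `w` lie below those of the minimal representative `v`, reflections that
shorten `w` raise its values while keeping them below those of `v`, until `v` is reached; hence
`v ≤ w`. And `v ≤ w` puts the coset of `v` into `X_w`: if the reflection in a root shortens `w` to
`u`, then in the `SL₂(K)` of this root the points `x(c) u P_r` with `c ≠ 0` lie in `B w P_r / P_r`,
and polynomials in `c` that vanish for all `c ≠ 0` vanish for `c = 0`, as `K` is infinite.

Both conditions are therefore comparisons of value sets. The weights `v(ω_r)` and `w(ω_r)` determine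
these sets, and counting letters `≥ c` turns the comparison into `|i_k - j_k| ≤ 1`; for `r = 1` and
`r = n` it follows from the nonnegativity of the sums of the coordinates `≥ c` of `v(ω_r)` and
`-w(ω_r)`.
-/

noncomputable section

namespace RichardsonBC

/-! ### Signed permutations and the Bruhat order -/

section WeylGroup

variable {n i : ℕ} {a b : ℤ} {u v w τ : Equiv.Perm ℤ}

/-- The nonzero integers of `[-n, n]`, which the Weyl group permutes. -/
def letters (n : ℕ) : Set ℤ := {a | a ≠ 0 ∧ |a| ≤ n}

lemma mem_letters : a ∈ letters n ↔ a ≠ 0 ∧ -(n : ℤ) ≤ a ∧ a ≤ n := by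
  rw [← abs_le]
  exact Iff.rfl

lemma map_neg_of_mem (hw : w ∈ weylGroup n) (a : ℤ) : w (-a) = -w a := hw.1 a

lemma map_zero_of_mem (hw : w ∈ weylGroup n) : w 0 = 0 := by
  have h := map_neg_of_mem hw 0
  rw [neg_zero] at h
  omega

lemma map_mem_letters (hw : w ∈ weylGroup n) (ha : a ∈ letters n) : w a ∈ letters n := by
  refine ⟨fun h => ha.1 (w.injective (h.trans (map_zero_of_mem hw).symm)), ?_⟩
  by_contra! h
  rw [w.injective (hw.2 _ h)] at h
  exact h.not_ge ha.2

/-- The reflection exchanging `a` with `b` and `-a` with `-b`. -/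
def signedSwap (a b : ℤ) : Equiv.Perm ℤ :=
  if b = -a then Equiv.swap a b else Equiv.swap a b * Equiv.swap (-a) (-b)

lemma signedSwap_apply (ha : a ≠ 0) (hb : b ≠ 0) (x : ℤ) :
    signedSwap a b x = if x = a then b else if x = b then a else if x = -a then -b
      else if x = -b then -a else x := by
  unfold signedSwap
  by_cases h : b = -a
  · subst h
    simp only [if_true, Equiv.swap_apply_def]
    split_ifs <;> omega
  · simp only [if_neg h, Equiv.Perm.mul_apply, Equiv.swap_apply_def]
    split_ifs <;> omega

lemma signedSwap_apply_left (ha : a ≠ 0) (hb : b ≠ 0) : signedSwap a b a = b := by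
  rw [signedSwap_apply ha hb, if_pos rfl]

lemma signedSwap_apply_right (ha : a ≠ 0) (hb : b ≠ 0) : signedSwap a b b = a := by
  rw [signedSwap_apply ha hb]
  split_ifs <;> omega

lemma signedSwap_apply_of_ne (ha : a ≠ 0) (hb : b ≠ 0) {x : ℤ} (h₁ : x ≠ a) (h₂ : x ≠ b)
    (h₃ : x ≠ -a) (h₄ : x ≠ -b) : signedSwap a b x = x := by
  rw [signedSwap_apply ha hb, if_neg h₁, if_neg h₂, if_neg h₃, if_neg h₄]

lemma signedSwap_comm (ha : a ≠ 0) (hb : b ≠ 0) : signedSwap a b = signedSwap b a := by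
  ext x
  rw [signedSwap_apply ha hb, signedSwap_apply hb ha]
  split_ifs <;> omega

lemma signedSwap_neg_neg (ha : a ≠ 0) (hb : b ≠ 0) : signedSwap (-b) (-a) = signedSwap a b := by
  ext x
  rw [signedSwap_apply ha hb, signedSwap_apply (neg_ne_zero.2 hb) (neg_ne_zero.2 ha)]
  split_ifs <;> omega

lemma signedSwap_mul_self (ha : a ≠ 0) (hb : b ≠ 0) : signedSwap a b * signedSwap a b = 1 := by
  ext x
  rw [Equiv.Perm.mul_apply, signedSwap_apply ha hb (signedSwap a b x), signedSwap_apply ha hb x,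
    Equiv.Perm.one_apply]
  split_ifs <;> omega

lemma signedSwap_inv (ha : a ≠ 0) (hb : b ≠ 0) : (signedSwap a b)⁻¹ = signedSwap a b :=
  inv_eq_of_mul_eq_one_left (signedSwap_mul_self ha hb)

lemma signedSwap_mem (ha : a ∈ letters n) (hb : b ∈ letters n) : signedSwap a b ∈ weylGroup n := by
  rw [mem_letters] at ha hb
  refine ⟨fun x => ?_, fun x hx => ?_⟩
  · rw [signedSwap_apply ha.1 hb.1, signedSwap_apply ha.1 hb.1]
    split_ifs <;> omega
  · rw [lt_abs] at hx
    apply signedSwap_apply_of_ne ha.1 hb.1 <;> omega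

lemma mul_signedSwap (hw : w ∈ weylGroup n) (a b : ℤ) :
    w * signedSwap a b = signedSwap (w a) (w b) * w := by
  unfold signedSwap
  by_cases h : b = -a
  · rw [if_pos h, if_pos (by rw [h, hw.1]), Equiv.mul_swap_eq_swap_mul]
  · rw [if_neg h, if_neg (by rw [← hw.1]; exact fun h' => h (w.injective h')), ← mul_assoc,
      Equiv.mul_swap_eq_swap_mul w, mul_assoc, Equiv.mul_swap_eq_swap_mul w, mul_assoc, hw.1, hw.1]

/-- The letter which `s_i` exchanges with `i`, so that `s_i` is uniformly a `signedSwap`. -/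
def lowerEnd (i : ℕ) : ℤ := if i = 1 then -1 else (i : ℤ) - 1

lemma lowerEnd_one : lowerEnd 1 = -1 := rfl

lemma lowerEnd_of_ne_one (hi : i ≠ 1) : lowerEnd i = (i : ℤ) - 1 := if_neg hi

lemma lowerEnd_lt (i : ℕ) : lowerEnd i < i := by
  unfold lowerEnd; split_ifs <;> omega

lemma lowerEnd_mem_letters (hi : 1 ≤ i) (hin : i ≤ n) : lowerEnd i ∈ letters n := by
  rw [mem_letters]; unfold lowerEnd; split_ifs <;> omega

lemma natCast_mem_letters (hi : 1 ≤ i) (hin : i ≤ n) : (i : ℤ) ∈ letters n := by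
  rw [mem_letters]; omega

lemma simpleReflection_eq_signedSwap (i : ℕ) :
    simpleReflection i = signedSwap (lowerEnd i) i := by
  unfold simpleReflection signedSwap lowerEnd
  by_cases h : i = 1
  · simp [h, Equiv.swap_comm]
  · rw [if_neg h, if_neg h, if_neg (by omega)]

lemma simpleReflection_mem (hi : 1 ≤ i) (hin : i ≤ n) : simpleReflection i ∈ weylGroup n := by
  rw [simpleReflection_eq_signedSwap]
  exact signedSwap_mem (lowerEnd_mem_letters hi hin) (natCast_mem_letters hi hin)

lemma simpleReflection_apply (hi : 1 ≤ i) (x : ℤ) :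
    simpleReflection i x = if x = lowerEnd i then (i : ℤ) else if x = i then lowerEnd i
      else if x = -lowerEnd i then -(i : ℤ) else if x = -(i : ℤ) then -lowerEnd i else x := by
  rw [simpleReflection_eq_signedSwap, signedSwap_apply (lowerEnd_mem_letters hi le_rfl).1
    (natCast_mem_letters hi le_rfl).1]

lemma simpleReflection_mul_self (hi : 1 ≤ i) : simpleReflection i * simpleReflection i = 1 := by
  rw [simpleReflection_eq_signedSwap]
  exact signedSwap_mul_self (lowerEnd_mem_letters hi le_rfl).1 (natCast_mem_letters hi le_rfl).1

lemma simpleReflection_inv (hi : 1 ≤ i) : (simpleReflection i)⁻¹ = simpleReflection i :=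
  inv_eq_of_mul_eq_one_left (simpleReflection_mul_self hi)

lemma simpleReflection_self (hi : 1 ≤ i) : simpleReflection i i = lowerEnd i := by
  rw [simpleReflection_eq_signedSwap]
  exact signedSwap_apply_right (lowerEnd_mem_letters hi le_rfl).1 (natCast_mem_letters hi le_rfl).1

lemma simpleReflection_lowerEnd (hi : 1 ≤ i) : simpleReflection i (lowerEnd i) = i := by
  rw [simpleReflection_eq_signedSwap]
  exact signedSwap_apply_left (lowerEnd_mem_letters hi le_rfl).1 (natCast_mem_letters hi le_rfl).1

lemma mul_simpleReflection (hw : w ∈ weylGroup n) (i : ℕ) :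
    w * simpleReflection i = signedSwap (w (lowerEnd i)) (w i) * w := by
  rw [simpleReflection_eq_signedSwap, mul_signedSwap hw]

lemma eq_of_simpleReflection_le (hi : 1 ≤ i) (ha : a ≠ 0) (hb : b ≠ 0) (hab : a < b)
    (h : simpleReflection i b ≤ simpleReflection i a) :
    a = lowerEnd i ∧ b = i ∨ a = -i ∧ b = -lowerEnd i := by
  rw [simpleReflection_apply hi, simpleReflection_apply hi] at h
  rcases eq_or_ne i 1 with rfl | h1
  · rw [lowerEnd_one] at *
    split_ifs at h <;> omega
  · rw [lowerEnd_of_ne_one h1] at *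
    split_ifs at h <;> omega

lemma signedSwap_eq_simpleReflection (hi : 1 ≤ i) (ha : a ≠ 0) (hb : b ≠ 0) (hab : a < b)
    (h : simpleReflection i b ≤ simpleReflection i a) : signedSwap a b = simpleReflection i := by
  rw [simpleReflection_eq_signedSwap]
  rcases eq_of_simpleReflection_le hi ha hb hab h with ⟨rfl, rfl⟩ | ⟨rfl, rfl⟩
  · rfl
  · exact signedSwap_neg_neg (lowerEnd_mem_letters hi le_rfl).1 (by omega)

/-- The simple reflection `s_i` lengthens `w` on the right. -/
def IsAscent (w : Equiv.Perm ℤ) (i : ℕ) : Prop := w (lowerEnd i) < w i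

lemma lt_of_not_isAscent (h : ¬ IsAscent w i) : w i < w (lowerEnd i) :=
  lt_of_le_of_ne (not_lt.1 h) fun h' => (lowerEnd_lt i).ne (w.injective h').symm

lemma lt_of_isAscent_of_two_le (hi : 2 ≤ i) (h : IsAscent w i) : w ((i : ℤ) - 1) < w i := by
  rwa [IsAscent, lowerEnd_of_ne_one (by omega)] at h

lemma pos_of_isAscent_one (hw : w ∈ weylGroup n) (h : IsAscent w 1) : 0 < w 1 := by
  rw [IsAscent, lowerEnd_one, map_neg_of_mem hw, Nat.cast_one] at h
  omega

/-- The Grassmannian elements for the node `r`: those without a descent other than `r`. They are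
the minimal representatives of the cosets of the parabolic subgroup of the other nodes. -/
def IsGrassmannian (r n : ℕ) (w : Equiv.Perm ℤ) : Prop :=
  ∀ i, 1 ≤ i → i ≤ n → i ≠ r → IsAscent w i

section Grassmannian

variable {r : ℕ}

lemma IsGrassmannian.strictMonoOn_Icc (h : IsGrassmannian r n w) (hr : 1 ≤ r) :
    StrictMonoOn w (Set.Icc r n) := by
  refine strictMonoOn_of_lt_succ Set.ordConnected_Icc fun x _ hx hx' => ?_
  rw [Int.succ_eq_succ, Int.succ, Set.mem_Icc] at *
  obtain ⟨i, hi⟩ := Int.eq_ofNat_of_zero_le (a := x + 1) (by omega)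
  have := lt_of_isAscent_of_two_le (by omega) (h i (by omega) (by omega) (by omega))
  rwa [hi, ← show (i : ℤ) - 1 = x by omega]

lemma IsGrassmannian.strictMonoOn_Ioo (h : IsGrassmannian r n w) (hw : w ∈ weylGroup n)
    (hr : r ≤ n + 1) : StrictMonoOn w (Set.Ioo (-r) r) := by
  have lt_succ : ∀ x : ℤ, 0 ≤ x → x + 1 < r → w x < w (x + 1) := by
    intro x hx hxr
    rcases hx.eq_or_lt with rfl | hx
    · rw [map_zero_of_mem hw]
      exact pos_of_isAscent_one hw (h 1 le_rfl (by omega) (by omega))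
    · obtain ⟨i, hi⟩ := Int.eq_ofNat_of_zero_le (a := x + 1) (by omega)
      have := lt_of_isAscent_of_two_le (by omega) (h i (by omega) (by omega) (by omega))
      rwa [hi, ← show (i : ℤ) - 1 = x by omega]
  refine strictMonoOn_of_lt_succ Set.ordConnected_Ioo fun x _ hx hx' => ?_
  rw [Int.succ_eq_succ, Int.succ, Set.mem_Ioo] at *
  rcases le_or_gt 0 x with hx0 | hx0
  · exact lt_succ x hx0 hx'.2
  · have := lt_succ (-(x + 1)) (by omega) (by omega)
    rw [show -(x + 1) + 1 = -x by ring, map_neg_of_mem hw, map_neg_of_mem hw] at this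
    omega

lemma mem_Ioo_of_mapsTo (hw : w ∈ weylGroup n) (hr : r ≤ n + 1)
    (hmap : ∀ x, w x ∈ Set.Icc (r : ℤ) n ↔ x ∈ Set.Icc (r : ℤ) n) {x : ℤ}
    (hx : x ∈ Set.Ioo (-r : ℤ) r) : w x ∈ Set.Ioo (-r : ℤ) r := by
  have h₁ := hmap x
  have h₂ := hmap (-x)
  rw [map_neg_of_mem hw] at h₂
  simp only [Set.mem_Icc, Set.mem_Ioo] at *
  rcases eq_or_ne x 0 with rfl | hx0
  · rwa [map_zero_of_mem hw]
  · have := mem_letters.1 (map_mem_letters hw (mem_letters.2 ⟨hx0, by omega, by omega⟩))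
    omega

lemma eq_one_of_strictMono (hw : w ∈ weylGroup n) (h : StrictMono w) : w = 1 := by
  let e : ℤ ≃o ℤ := h.orderIsoOfSurjective w w.surjective
  have hsucc : ∀ x, w (x + 1) = w x + 1 := e.map_succ
  ext x
  induction x with
  | zero => exact map_zero_of_mem hw
  | succ k ih => rw [hsucc, ih, Equiv.Perm.one_apply, Equiv.Perm.one_apply]
  | pred k ih =>
    have := hsucc (-k - 1)
    rw [sub_add_cancel, ih] at this
    rw [Equiv.Perm.one_apply] at *
    omega

lemma eq_one_of_strictMonoOn (hw : w ∈ weylGroup n) (hr : r ≤ n + 1)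
    (hmap : ∀ x, w x ∈ Set.Icc (r : ℤ) n ↔ x ∈ Set.Icc (r : ℤ) n)
    (hIcc : StrictMonoOn w (Set.Icc r n)) (hIoo : StrictMonoOn w (Set.Ioo (-r) r)) : w = 1 := by
  have lt_succ : ∀ x : ℤ, 0 ≤ x → w x < w (x + 1) := by
    intro x hx
    have hmaps : ∀ y, y ∈ Set.Icc (r : ℤ) n → w y ∈ Set.Icc (r : ℤ) n := fun y => (hmap y).2
    have hfix : ∀ y : ℤ, (n : ℤ) < y → w y = y := fun y hy => hw.2 y (hy.trans_le (le_abs_self y))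
    rcases lt_trichotomy (x + 1) r with h | h | h
    · exact hIoo ⟨by omega, by omega⟩ ⟨by omega, h⟩ (lt_add_one x)
    · have h₁ := mem_Ioo_of_mapsTo hw hr hmap (x := x) ⟨by omega, by omega⟩
      refine h₁.2.trans_le ?_
      rcases le_or_gt (x + 1) n with h₂ | h₂
      · exact (hmaps _ ⟨h.ge, h₂⟩).1
      · rw [hfix _ h₂]
        exact h.ge
    · rcases le_or_gt (x + 1) n with h₂ | h₂
      · exact hIcc ⟨by omega, by omega⟩ ⟨by omega, h₂⟩ (lt_add_one x)
      · rw [hfix _ h₂]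
        rcases le_or_gt x n with h₃ | h₃
        · exact (hmaps x ⟨by omega, h₃⟩).2.trans_lt h₂
        · rw [hfix _ h₃]
          exact lt_add_one x
  refine eq_one_of_strictMono hw (strictMono_int_of_lt_succ fun x => ?_)
  rcases le_or_gt 0 x with hx | hx
  · exact lt_succ x hx
  · have := lt_succ (-(x + 1)) (by omega)
    rw [show -(x + 1) + 1 = -x by ring, map_neg_of_mem hw, map_neg_of_mem hw] at this
    omega

lemma eq_one_of_isAscent (hw : w ∈ weylGroup n) (h : ∀ i, 1 ≤ i → i ≤ n → IsAscent w i) :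
    w = 1 := by
  have hG : IsGrassmannian (n + 1) n w := fun i h1 h2 _ => h i h1 h2
  refine eq_one_of_strictMonoOn hw le_rfl (fun x => ?_) (hG.strictMonoOn_Icc (by omega))
    (hG.strictMonoOn_Ioo hw le_rfl)
  simp only [Set.mem_Icc]
  omega

end Grassmannian

/-- The inversions of `w` in `[-n, n]`. They serve to write `w` as a word in the simple
reflections. -/
def inversions (n : ℕ) (w : Equiv.Perm ℤ) : Finset (ℤ × ℤ) :=
  (Finset.Icc (-n : ℤ) n ×ˢ Finset.Icc (-n : ℤ) n).filter
    fun p => p.1 ≠ 0 ∧ p.2 ≠ 0 ∧ p.1 < p.2 ∧ w p.2 < w p.1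

lemma mem_inversions : (a, b) ∈ inversions n w ↔
    a ∈ letters n ∧ b ∈ letters n ∧ a < b ∧ w b < w a := by
  simp only [inversions, Finset.mem_filter, Finset.mem_product, Finset.mem_Icc, mem_letters]
  tauto

lemma card_inversions_mul_simpleReflection_lt (hi : 1 ≤ i) (hin : i ≤ n) (hw : w ∈ weylGroup n)
    (h : ¬ IsAscent w i) :
    (inversions n (w * simpleReflection i)).card < (inversions n w).card := by
  have hlt := lt_of_not_isAscent h
  have hmem : (lowerEnd i, (i : ℤ)) ∈ inversions n w := mem_inversions.2
    ⟨lowerEnd_mem_letters hi hin, natCast_mem_letters hi hin, lowerEnd_lt i, hlt⟩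
  refine (Finset.card_le_card_of_injOn (Prod.map (simpleReflection i) (simpleReflection i)) ?_
    ((simpleReflection i).injective.prodMap (simpleReflection i).injective).injOn).trans_lt
    (Finset.card_erase_lt_of_mem hmem)
  rintro ⟨a, b⟩ hab
  obtain ⟨ha, hb, hab, hwab⟩ := mem_inversions.1 hab
  have hs := simpleReflection_mem hi hin
  rw [Equiv.Perm.mul_apply, Equiv.Perm.mul_apply] at hwab
  have hsab : simpleReflection i a < simpleReflection i b := by
    by_contra! hle
    rcases eq_of_simpleReflection_le hi ha.1 hb.1 hab hle with ⟨rfl, rfl⟩ | ⟨rfl, rfl⟩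
    · rw [simpleReflection_self hi, simpleReflection_lowerEnd hi] at hwab
      exact hwab.not_gt hlt
    · rw [map_neg_of_mem hs, map_neg_of_mem hs, simpleReflection_self hi,
        simpleReflection_lowerEnd hi, map_neg_of_mem hw, map_neg_of_mem hw] at hwab
      exact (neg_lt_neg_iff.1 hwab).not_gt hlt
  refine Finset.mem_coe.2 (Finset.mem_erase.2 ⟨fun he => ?_, mem_inversions.2
    ⟨map_mem_letters hs ha, map_mem_letters hs hb, hsab, hwab⟩⟩)
  obtain ⟨ha', hb'⟩ := Prod.mk.inj he
  rw [← simpleReflection_self hi] at ha'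
  rw [← simpleReflection_lowerEnd hi] at hb'
  rw [(simpleReflection i).injective ha', (simpleReflection i).injective hb'] at hab
  exact hab.not_gt (lowerEnd_lt i)

/-- The words in the simple reflections `s_1, …, s_n`. -/
def IsWord (n : ℕ) (l : List ℕ) : Prop := ∀ i ∈ l, 1 ≤ i ∧ i ≤ n

lemma isWord_cons {l : List ℕ} : IsWord n (i :: l) ↔ (1 ≤ i ∧ i ≤ n) ∧ IsWord n l :=
  List.forall_mem_cons

lemma exists_word (hw : w ∈ weylGroup n) :
    ∃ l, IsWord n l ∧ (l.map simpleReflection).prod = w := by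
  induction hk : (inversions n w).card using Nat.strong_induction_on generalizing w with
  | _ k ih =>
    by_cases hasc : ∀ i, 1 ≤ i → i ≤ n → IsAscent w i
    · exact ⟨[], List.forall_mem_nil _, (eq_one_of_isAscent hw hasc).symm⟩
    · push Not at hasc
      obtain ⟨i, hi, hin, hdesc⟩ := hasc
      obtain ⟨l, hl, hprod⟩ := ih _ (hk ▸ card_inversions_mul_simpleReflection_lt hi hin hw hdesc)
        (mul_mem hw (simpleReflection_mem hi hin)) rfl
      refine ⟨l ++ [i], List.forall_mem_append.2 ⟨hl, List.forall_mem_singleton.2 ⟨hi, hin⟩⟩, ?_⟩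
      rw [List.map_append, List.prod_append, hprod, List.map_singleton, List.prod_singleton,
        mul_assoc, simpleReflection_mul_self hi, mul_one]

-- Strong exchange: the letter deleted is the first whose reflection makes the pair change order.
lemma exists_shorter_word {l : List ℕ} (hl : IsWord n l) (ha : a ≠ 0) (hb : b ≠ 0) (hab : a < b)
    (h : (l.map simpleReflection).prod⁻¹ b < (l.map simpleReflection).prod⁻¹ a) :
    ∃ l', IsWord n l' ∧ l'.length < l.length ∧
      (l'.map simpleReflection).prod = signedSwap a b * (l.map simpleReflection).prod := by
  induction l generalizing a b with
  | nil => exact absurd h hab.not_gt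
  | cons i l ih =>
    obtain ⟨⟨hi, hin⟩, hl⟩ := isWord_cons.1 hl
    have hs := simpleReflection_mem hi hin
    have hss : ∀ x, simpleReflection i (simpleReflection i x) = x := fun x => by
      rw [← Equiv.Perm.mul_apply, simpleReflection_mul_self hi, Equiv.Perm.one_apply]
    rw [List.map_cons, List.prod_cons, mul_inv_rev,
      inv_eq_of_mul_eq_one_left (simpleReflection_mul_self hi)] at h
    rcases lt_or_ge (simpleReflection i a) (simpleReflection i b) with hlt | hle
    · have hne : ∀ {x : ℤ}, x ≠ 0 → simpleReflection i x ≠ 0 := fun hx h0 =>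
        hx ((simpleReflection i).injective (h0.trans (map_zero_of_mem hs).symm))
      obtain ⟨l', hl', hlen, hprod⟩ := ih hl (hne ha) (hne hb) hlt h
      refine ⟨i :: l', isWord_cons.2 ⟨⟨hi, hin⟩, hl'⟩, Nat.succ_lt_succ hlen, ?_⟩
      rw [List.map_cons, List.prod_cons, hprod, ← mul_assoc, mul_signedSwap hs, hss, hss,
        List.map_cons, List.prod_cons, mul_assoc]
    · refine ⟨l, hl, Nat.lt_succ_self _, ?_⟩
      rw [signedSwap_eq_simpleReflection hi ha hb hab hle, List.map_cons, List.prod_cons,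
        ← mul_assoc, simpleReflection_mul_self hi, one_mul]

lemma length_prod_le {l : List ℕ} (hl : IsWord n l) :
    length n (l.map simpleReflection).prod ≤ l.length :=
  Nat.sInf_le ⟨l, rfl, hl, rfl⟩

lemma exists_reduced_word (hw : w ∈ weylGroup n) :
    ∃ l, IsWord n l ∧ (l.map simpleReflection).prod = w ∧ l.length = length n w := by
  obtain ⟨l, hl, hprod⟩ := exists_word hw
  obtain ⟨l', h₁, h₂, h₃⟩ := Nat.sInf_mem (s := {k | ∃ l : List ℕ, l.length = k ∧
    IsWord n l ∧ (l.map simpleReflection).prod = w}) ⟨l.length, l, rfl, hl, hprod⟩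
  exact ⟨l', h₂, h₃, h₁⟩

lemma length_signedSwap_mul_lt (hu : u ∈ weylGroup n) (ha : a ≠ 0) (hb : b ≠ 0) (hab : a < b)
    (h : u⁻¹ b < u⁻¹ a) : length n (signedSwap a b * u) < length n u := by
  obtain ⟨l, hl, rfl, hlen⟩ := exists_reduced_word hu
  obtain ⟨l', hl', hlt, hprod⟩ := exists_shorter_word hl ha hb hab h
  rw [← hprod, ← hlen]
  exact (length_prod_le hl').trans_lt hlt

lemma isReflection_signedSwap (ha : a ∈ letters n) (hb : b ∈ letters n) (hab : a ≠ b) :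
    IsReflection n (signedSwap a b) := by
  have hn : 1 ≤ n := by rw [mem_letters] at ha; omega
  have h1 : (1 : ℤ) ∈ letters n := natCast_mem_letters le_rfl hn
  have hg := signedSwap_mem h1 ha
  have hg1 : signedSwap 1 a 1 = a := signedSwap_apply_left one_ne_zero ha.1
  by_cases hba : b = -a
  · refine ⟨signedSwap 1 a, hg, 1, le_rfl, hn, ?_⟩
    rw [mul_simpleReflection hg, mul_inv_cancel_right, lowerEnd_one, map_neg_of_mem hg,
      Nat.cast_one, hg1, ← hba, signedSwap_comm hb.1 ha.1]
  · obtain ⟨c, hgc⟩ := (signedSwap 1 a).surjective b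
    have hc : c ∈ letters n := by
      rw [← Equiv.Perm.inv_eq_iff_eq.2 hgc.symm]
      exact map_mem_letters (inv_mem hg) hb
    have hc1 : c ≠ 1 := by rintro rfl; exact hab (hg1.symm.trans hgc)
    have hcn1 : c ≠ -1 := by
      rintro rfl
      rw [map_neg_of_mem hg, hg1] at hgc
      exact hba hgc.symm
    have hn2 : 2 ≤ n := by rw [mem_letters] at hc; omega
    have h2 : (2 : ℤ) ∈ letters n := natCast_mem_letters one_le_two hn2
    have hm := mul_mem hg (signedSwap_mem h2 hc)
    refine ⟨_, hm, 2, one_le_two, hn2, ?_⟩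
    have h21 : signedSwap 2 c 1 = 1 := by
      apply signedSwap_apply_of_ne two_ne_zero hc.1 <;> omega
    rw [mul_simpleReflection hm, mul_inv_cancel_right, lowerEnd_of_ne_one (by norm_num),
      Nat.cast_ofNat, show (2 : ℤ) - 1 = 1 by norm_num, Equiv.Perm.mul_apply, Equiv.Perm.mul_apply,
      signedSwap_apply_left two_ne_zero hc.1, hgc, h21, hg1]

lemma isReflection_iff :
    IsReflection n τ ↔ ∃ a ∈ letters n, ∃ b ∈ letters n, a < b ∧ τ = signedSwap a b := by
  constructor
  · rintro ⟨g, hg, i, hi, hin, rfl⟩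
    rw [mul_simpleReflection hg, mul_inv_cancel_right]
    have h₁ := map_mem_letters hg (lowerEnd_mem_letters hi hin)
    have h₂ := map_mem_letters hg (natCast_mem_letters hi hin)
    rcases lt_trichotomy (g (lowerEnd i)) (g i) with h | h | h
    · exact ⟨_, h₁, _, h₂, h, rfl⟩
    · exact absurd (g.injective h) (lowerEnd_lt i).ne
    · exact ⟨_, h₂, _, h₁, h, signedSwap_comm h₁.1 h₂.1⟩
  · rintro ⟨a, ha, b, hb, hab, rfl⟩
    exact isReflection_signedSwap ha hb hab.ne

lemma bruhat_step_iff (hu : u ∈ weylGroup n) :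
    (∃ τ, IsReflection n τ ∧ v = τ * u ∧ length n u < length n v) ↔
      ∃ a ∈ letters n, ∃ b ∈ letters n, a < b ∧ u⁻¹ a < u⁻¹ b ∧ v = signedSwap a b * u := by
  constructor
  · rintro ⟨τ, hτ, rfl, hlen⟩
    obtain ⟨a, ha, b, hb, hab, rfl⟩ := isReflection_iff.1 hτ
    refine ⟨a, ha, b, hb, hab, ?_, rfl⟩
    by_contra! hle
    have hlt := hle.lt_of_ne fun h => hab.ne (u⁻¹.injective h).symm
    exact (length_signedSwap_mul_lt hu ha.1 hb.1 hab hlt).not_gt hlen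
  · rintro ⟨a, ha, b, hb, hab, hlt, rfl⟩
    refine ⟨_, isReflection_iff.2 ⟨a, ha, b, hb, hab, rfl⟩, rfl, ?_⟩
    have := length_signedSwap_mul_lt (mul_mem (signedSwap_mem ha hb) hu) ha.1 hb.1 hab (by
      rw [mul_inv_rev, signedSwap_inv ha.1 hb.1, Equiv.Perm.mul_apply, Equiv.Perm.mul_apply,
        signedSwap_apply_left ha.1 hb.1, signedSwap_apply_right ha.1 hb.1]
      exact hlt)
    rwa [← mul_assoc, signedSwap_mul_self ha.1 hb.1, one_mul] at this

end WeylGroup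

/-! ### The Gale order and the Bruhat order -/

section Gale

variable {n r i : ℕ} {a b m : ℤ} {A C S : Finset ℤ} {v w : Equiv.Perm ℤ}

/-- The number of elements of `S` that are at least `c`. -/
def upCount (S : Finset ℤ) (c : ℤ) : ℤ := ∑ x ∈ S, if c ≤ x then 1 else 0

/-- The Gale order `C ≤ A` on finite sets of integers. For sets of the same size it compares the
`k`-th largest elements for all `k`. -/
def GaleLE (C A : Finset ℤ) : Prop := ∀ c, upCount C c ≤ upCount A c

/-- The sets of letters containing at most one of `x` and `-x`. They index the isotropic coordinate
subspaces of the natural representation. -/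
def Admissible (n : ℕ) (S : Finset ℤ) : Prop := ∀ x ∈ S, x ∈ letters n ∧ -x ∉ S

lemma upCount_eq_add (S : Finset ℤ) (c : ℤ) :
    upCount S c = upCount S (c + 1) + if c ∈ S then 1 else 0 := by
  unfold upCount
  rw [← Finset.sum_ite_eq' S c (fun _ => (1 : ℤ)), ← Finset.sum_add_distrib]
  refine Finset.sum_congr rfl fun x _ => ?_
  split_ifs <;> omega

lemma upCount_of_forall_lt {c : ℤ} (h : ∀ x ∈ S, x < c) : upCount S c = 0 :=
  Finset.sum_eq_zero fun x hx => if_neg (h x hx).not_ge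

lemma upCount_of_forall_le {c : ℤ} (h : ∀ x ∈ S, c ≤ x) : upCount S c = S.card := by
  rw [upCount, Finset.sum_congr rfl fun x hx => if_pos (h x hx), Finset.sum_const, nsmul_one]

lemma exists_upCount_eq_of_card_eq (hcard : A.card = C.card) (m : ℤ) :
    ∃ c ≤ m, upCount A c = upCount C c := by
  obtain ⟨l, hl⟩ := (insert m (A ∪ C)).bddBelow
  refine ⟨l, hl (by simp), ?_⟩
  rw [upCount_of_forall_le fun x hx => hl (by simp [hx]),
    upCount_of_forall_le fun x hx => hl (by simp [hx]), hcard]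

lemma exists_upCount_succ_eq (A C : Finset ℤ) (m : ℤ) :
    ∃ c ≥ m, upCount A (c + 1) = upCount C (c + 1) := by
  obtain ⟨l, hl⟩ := (insert m (A ∪ C)).bddAbove
  refine ⟨l, hl (by simp), ?_⟩
  rw [upCount_of_forall_lt fun x hx => Int.lt_add_one_of_le (hl (by simp [hx])),
    upCount_of_forall_lt fun x hx => Int.lt_add_one_of_le (hl (by simp [hx]))]

lemma GaleLE.exists_lt_mem_sdiff (hle : GaleLE C A) (hcard : A.card = C.card) (hm : m ∈ A \ C) :
    ∃ p ∈ C \ A, p < m ∧ upCount A p = upCount C p ∧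
      ∀ c, p < c → c ≤ m → upCount C c < upCount A c := by
  rw [Finset.mem_sdiff] at hm
  obtain ⟨c₀, hc₀⟩ := exists_upCount_eq_of_card_eq hcard m
  obtain ⟨p, ⟨hpm, hp⟩, hmax⟩ := Int.exists_greatest_of_bdd
    (P := fun p => p ≤ m ∧ upCount A p = upCount C p) ⟨m, fun _ h => h.1⟩ ⟨c₀, hc₀⟩
  have hlt : ∀ c, p < c → c ≤ m → upCount C c < upCount A c := fun c hpc hcm =>
    (hle c).lt_of_ne fun h => (hmax c ⟨hcm, h.symm⟩).not_gt hpc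
  have hpm : p < m := by
    refine hpm.lt_of_ne ?_
    rintro rfl
    have := hle (p + 1)
    rw [upCount_eq_add A, upCount_eq_add C, if_pos hm.1, if_neg hm.2] at hp
    omega
  refine ⟨p, ?_, hpm, hp, hlt⟩
  have := hlt (p + 1) (lt_add_one p) hpm
  rw [upCount_eq_add A, upCount_eq_add C] at hp
  rw [Finset.mem_sdiff]
  split_ifs at hp <;> first | omega | tauto

lemma GaleLE.exists_gt_mem_sdiff (hle : GaleLE C A) (ha : a ∈ C \ A) :
    ∃ q ∈ A \ C, a < q ∧ ∀ c, a < c → c ≤ q → upCount C c < upCount A c := by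
  rw [Finset.mem_sdiff] at ha
  obtain ⟨c₀, hc₀⟩ := exists_upCount_succ_eq A C a
  obtain ⟨q, ⟨haq, hq⟩, hmin⟩ := Int.exists_least_of_bdd
    (P := fun q => a ≤ q ∧ upCount A (q + 1) = upCount C (q + 1)) ⟨a, fun _ h => h.1⟩ ⟨c₀, hc₀⟩
  have hlt : ∀ c, a < c → c ≤ q → upCount C c < upCount A c := fun c hac hcq =>
    (hle c).lt_of_ne fun h => by
      have := hmin (c - 1) ⟨by omega, by rw [sub_add_cancel, h]⟩
      omega
  have haq : a < q := by
    refine haq.lt_of_ne ?_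
    rintro rfl
    have := hle a
    rw [upCount_eq_add A, upCount_eq_add C, if_neg ha.2, if_pos ha.1] at this
    omega
  refine ⟨q, ?_, haq, hlt⟩
  have := hlt q haq le_rfl
  rw [upCount_eq_add A, upCount_eq_add C, hq] at this
  rw [Finset.mem_sdiff]
  split_ifs at this <;> first | omega | tauto

lemma upCount_image (S : Finset ℤ) (τ : Equiv.Perm ℤ) (c : ℤ) :
    upCount (S.image τ) c = upCount S c +
      ∑ x ∈ S, ((if c ≤ τ x then 1 else 0) - if c ≤ x then 1 else 0) := by
  unfold upCount
  rw [Finset.sum_image τ.injective.injOn, ← Finset.sum_add_distrib]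
  exact Finset.sum_congr rfl fun _ _ => (add_sub_cancel _ _).symm

lemma upCount_image_signedSwap_of_mem (hS : Admissible n S) (ha : a ∈ S) (hb : b ∉ S) (hb0 : b ≠ 0)
    (h : -b ∉ S ∨ b = -a) (c : ℤ) :
    upCount (S.image (signedSwap a b)) c =
      upCount S c + ((if c ≤ b then 1 else 0) - if c ≤ a then 1 else 0) := by
  have ha0 := (hS a ha).1.1
  rw [upCount_image, Finset.sum_eq_single_of_mem a ha, signedSwap_apply_left ha0 hb0]
  intro x hx hxa
  rw [signedSwap_apply_of_ne ha0 hb0 hxa, sub_self]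
  · rintro rfl; exact hb hx
  · rintro rfl; exact (hS a ha).2 hx
  · rintro rfl
    rcases h with h | rfl
    · exact h hx
    · exact hxa (neg_neg a)

lemma upCount_image_signedSwap_of_mem_of_neg_mem (hS : Admissible n S) (ha : a ∈ S) (hb : -b ∈ S)
    (hab : a ≠ -b) (c : ℤ) :
    upCount (S.image (signedSwap a b)) c =
      upCount S c + ((if c ≤ b then 1 else 0) - (if c ≤ a then 1 else 0) +
        ((if c ≤ -a then 1 else 0) - if c ≤ -b then 1 else 0)) := by
  have ha0 := (hS a ha).1.1
  have hb0 : b ≠ 0 := neg_ne_zero.1 (hS _ hb).1.1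
  have hbS : b ∉ S := by simpa only [neg_neg] using (hS _ hb).2
  have hmap : signedSwap a b (-b) = -a := by
    have : a ≠ b := fun h => hbS (h ▸ ha)
    rw [signedSwap_apply ha0 hb0]
    split_ifs <;> omega
  have hsub : {a, -b} ⊆ S := Finset.insert_subset ha (Finset.singleton_subset_iff.2 hb)
  rw [upCount_image, ← Finset.sum_subset hsub, Finset.sum_pair hab, signedSwap_apply_left ha0 hb0,
    hmap]
  intro x hx hx'
  rw [Finset.mem_insert, Finset.mem_singleton, not_or] at hx'
  rw [signedSwap_apply_of_ne ha0 hb0 hx'.1 _ _ hx'.2, sub_self]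
  · rintro rfl; exact hbS hx
  · rintro rfl; exact (hS a ha).2 hx

lemma GaleLE.image_signedSwap_of_mem (hle : GaleLE C A) (hC : Admissible n C) (ha : a ∈ C)
    (hb : b ∉ C) (hb0 : b ≠ 0) (h : -b ∉ C ∨ b = -a)
    (hlt : ∀ c, a < c → c ≤ b → upCount C c < upCount A c) :
    GaleLE (C.image (signedSwap a b)) A := fun c => by
  rw [upCount_image_signedSwap_of_mem hC ha hb hb0 h]
  have h₁ := hle c
  have h₂ := hlt c
  split_ifs <;> omega

lemma GaleLE.image_signedSwap_of_mem_of_neg_mem (hle : GaleLE C A) (hC : Admissible n C)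
    (ha : a ∈ C) (hb : -b ∈ C) (hab : a ≠ -b) (hdisj : b ≤ -b ∨ -a ≤ a)
    (hlt : ∀ c, a < c → c ≤ b → upCount C c < upCount A c)
    (hlt' : ∀ c, -b < c → c ≤ -a → upCount C c < upCount A c) :
    GaleLE (C.image (signedSwap a b)) A := fun c => by
  rw [upCount_image_signedSwap_of_mem_of_neg_mem hC ha hb hab]
  have h₁ := hle c
  have h₂ := hlt c
  have h₃ := hlt' c
  split_ifs <;> omega

lemma GaleLE.exists_image_signedSwap (hle : GaleLE C A) (hA : Admissible n A)
    (hC : Admissible n C) (hcard : A.card = C.card) (hne : A ≠ C) :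
    ∃ a ∈ C, ∃ b ∉ C, b ∈ letters n ∧ a < b ∧ GaleLE (C.image (signedSwap a b)) A := by
  -- `signedSwap p m` is the natural move, but if `-m ∈ C`, it also carries `-m` to `-p`. In that
  -- case `-m` itself can be raised, to `m` or to `q`, or the two moves do not interfere.
  have hAC : (A \ C).Nonempty :=
    Finset.sdiff_nonempty.2 fun h => hne (Finset.eq_of_subset_of_card_le h hcard.ge)
  obtain ⟨m, hm, hmax⟩ := (A \ C).exists_max_image id hAC
  obtain ⟨p, hp, hpm, hp_eq, hp_lt⟩ := hle.exists_lt_mem_sdiff hcard hm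
  rw [Finset.mem_sdiff] at hm hp
  have hml := (hA m hm.1).1
  by_cases hneg : -m ∈ C
  swap
  · exact ⟨p, hp.1, m, hm.2, hml, hpm,
      hle.image_signedSwap_of_mem hC hp.1 hm.2 hml.1 (.inl hneg) hp_lt⟩
  obtain ⟨q, hq, hmq, hq_lt⟩ :=
    hle.exists_gt_mem_sdiff (Finset.mem_sdiff.2 ⟨hneg, (hA m hm.1).2⟩)
  have hqm : q ≤ m := hmax q hq
  rw [Finset.mem_sdiff] at hq
  have hql := (hA q hq.1).1
  rcases le_or_gt p (-m) with hpm' | hpm'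
  · exact ⟨-m, hneg, m, hm.2, hml, by omega, hle.image_signedSwap_of_mem hC hneg hm.2 hml.1
      (.inr (neg_neg m).symm) fun c hc hcm => hp_lt c (by omega) hcm⟩
  have hqp : q < p := by
    by_contra! h
    exact (hq_lt p hpm' h).ne' hp_eq
  by_cases hqneg : -q ∈ C
  swap
  · exact ⟨-m, hneg, q, hq.2, hql, hmq,
      hle.image_signedSwap_of_mem hC hneg hq.2 hql.1 (.inl hqneg) hq_lt⟩
  rcases le_or_gt p (-q) with hpq | hpq
  · exact ⟨-m, hneg, q, hq.2, hql, hmq, hle.image_signedSwap_of_mem_of_neg_mem hC hneg hqneg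
      (by omega) (by omega) hq_lt fun c hc hcm => hp_lt c (by omega) (by omega)⟩
  · exact ⟨p, hp.1, m, hm.2, hml, hpm, hle.image_signedSwap_of_mem_of_neg_mem hC hp.1 hneg
      (by omega) (by omega) hp_lt fun c hc hcm => hq_lt c hc (by omega)⟩

/-- The set of values of `w` on `[r, n]`: it determines the coset of `w` modulo the parabolic
subgroup of the nodes other than `r`. -/
def values (r n : ℕ) (w : Equiv.Perm ℤ) : Finset ℤ :=
  (Finset.Icc r n).image fun j : ℕ => w j

lemma mem_values {x : ℤ} : x ∈ values r n w ↔ w⁻¹ x ∈ Set.Icc (r : ℤ) n := by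
  rw [values, Finset.mem_image, Set.mem_Icc]
  constructor
  · rintro ⟨j, hj, rfl⟩
    rw [Finset.mem_Icc] at hj
    rw [Equiv.Perm.coe_inv, Equiv.symm_apply_apply]
    omega
  · rintro ⟨h₁, h₂⟩
    refine ⟨(w⁻¹ x).toNat, Finset.mem_Icc.2 (by omega), ?_⟩
    rw [Int.toNat_of_nonneg (by omega), Equiv.Perm.coe_inv, Equiv.apply_symm_apply]

lemma apply_mem_values {x : ℤ} : w x ∈ values r n w ↔ x ∈ Set.Icc (r : ℤ) n := by
  rw [mem_values, Equiv.Perm.coe_inv, Equiv.symm_apply_apply]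

lemma sum_values {M : Type*} [AddCommMonoid M] (r n : ℕ) (w : Equiv.Perm ℤ) (f : ℤ → M) :
    ∑ x ∈ values r n w, f x = ∑ j ∈ Finset.Icc r n, f (w j) :=
  Finset.sum_image (w.injective.comp Nat.cast_injective).injOn

lemma card_values (r n : ℕ) (w : Equiv.Perm ℤ) : (values r n w).card = (Finset.Icc r n).card :=
  Finset.card_image_of_injective _ (w.injective.comp Nat.cast_injective)

lemma values_mul (r n : ℕ) (v w : Equiv.Perm ℤ) :
    values r n (v * w) = (values r n w).image v := by
  rw [values, values, Finset.image_image]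
  rfl

lemma admissible_values (hr : 1 ≤ r) (hw : w ∈ weylGroup n) : Admissible n (values r n w) := by
  intro x hx
  rw [mem_values, Set.mem_Icc] at *
  refine ⟨?_, ?_⟩
  · have := map_mem_letters hw (a := w⁻¹ x) (mem_letters.2 (by omega))
    rwa [Equiv.Perm.coe_inv, Equiv.apply_symm_apply] at this
  · rw [map_neg_of_mem (inv_mem hw)]
    omega

lemma values_mul_simpleReflection (hi : 1 ≤ i) (hin : i ≤ n) (hir : i ≠ r) (hr : 1 ≤ r) :
    values r n (w * simpleReflection i) = values r n w := by
  ext x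
  rw [mem_values, mem_values, mul_inv_rev, simpleReflection_inv hi, Equiv.Perm.mul_apply,
    simpleReflection_apply hi, Set.mem_Icc, Set.mem_Icc]
  unfold lowerEnd
  split_ifs <;> omega

lemma IsGrassmannian.eq_of_values_eq (hvG : IsGrassmannian r n v) (hwG : IsGrassmannian r n w)
    (hv : v ∈ weylGroup n) (hw : w ∈ weylGroup n) (hr : 1 ≤ r) (hrn : r ≤ n + 1)
    (h : values r n v = values r n w) : v = w := by
  have hu := mul_mem (inv_mem hv) hw
  have hmap : ∀ x, (v⁻¹ * w) x ∈ Set.Icc (r : ℤ) n ↔ x ∈ Set.Icc (r : ℤ) n := fun x => by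
    rw [Equiv.Perm.mul_apply, ← mem_values, h, apply_mem_values]
  have lt_iff : ∀ {s : Set ℤ}, StrictMonoOn v s → (∀ x ∈ s, (v⁻¹ * w) x ∈ s) →
      StrictMonoOn w s → StrictMonoOn (v⁻¹ * w) s := fun hvs hs hws x hx y hy hxy => by
    rw [← hvs.lt_iff_lt (hs x hx) (hs y hy), Equiv.Perm.mul_apply, Equiv.Perm.mul_apply,
      Equiv.Perm.coe_inv, Equiv.apply_symm_apply, Equiv.apply_symm_apply]
    exact hws hx hy hxy
  refine inv_mul_eq_one.1 (eq_one_of_strictMonoOn hu hrn hmap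
    (lt_iff (hvG.strictMonoOn_Icc hr) (fun x => (hmap x).2) (hwG.strictMonoOn_Icc hr))
    (lt_iff (hvG.strictMonoOn_Ioo hv hrn) (fun x => mem_Ioo_of_mapsTo hu hrn hmap)
      (hwG.strictMonoOn_Ioo hw hrn)))

lemma IsGrassmannian.exists_galeLE_signedSwap_mul (hvG : IsGrassmannian r n v)
    (hv : v ∈ weylGroup n) (hw : w ∈ weylGroup n) (hr : 1 ≤ r) (hrn : r ≤ n + 1) (hne : v ≠ w)
    (hle : GaleLE (values r n w) (values r n v)) :
    ∃ a ∈ letters n, ∃ b ∈ letters n, a < b ∧ w⁻¹ b < w⁻¹ a ∧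
      GaleLE (values r n (signedSwap a b * w)) (values r n v) := by
  by_cases hwG : IsGrassmannian r n w
  · have hC := admissible_values hr hw
    obtain ⟨a, ha, b, hb, hbl, hab, hle'⟩ := hle.exists_image_signedSwap (admissible_values hr hv)
      hC (by rw [card_values, card_values])
      fun h => hne (hvG.eq_of_values_eq hwG hv hw hr hrn h)
    refine ⟨a, (hC a ha).1, b, hbl, hab, ?_, by rwa [values_mul]⟩
    have hwb := (mem_letters.1 (map_mem_letters (inv_mem hw) hbl)).2.2
    rw [mem_values, Set.mem_Icc] at ha hb
    omega
  · unfold IsGrassmannian at hwG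
    push Not at hwG
    obtain ⟨i, hi, hin, hir, hdesc⟩ := hwG
    have hl := map_mem_letters hw (lowerEnd_mem_letters hi hin)
    have hi' := map_mem_letters hw (natCast_mem_letters hi hin)
    refine ⟨_, hi', _, hl, lt_of_not_isAscent hdesc, ?_, ?_⟩
    · rw [Equiv.Perm.coe_inv, Equiv.symm_apply_apply, Equiv.symm_apply_apply]
      exact lowerEnd_lt i
    · rwa [signedSwap_comm hi'.1 hl.1, ← mul_simpleReflection hw,
        values_mul_simpleReflection hi hin hir hr]

theorem IsGrassmannian.bruhatLE_of_galeLE (hvG : IsGrassmannian r n v) (hv : v ∈ weylGroup n)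
    (hw : w ∈ weylGroup n) (hr : 1 ≤ r) (hrn : r ≤ n + 1)
    (hle : GaleLE (values r n w) (values r n v)) : BruhatLE n v w := by
  induction hk : length n w using Nat.strong_induction_on generalizing w with
  | _ k ih =>
    by_cases hne : v = w
    · exact hne ▸ Relation.ReflTransGen.refl
    obtain ⟨a, ha, b, hb, hab, hlt, hle'⟩ :=
      hvG.exists_galeLE_signedSwap_mul hv hw hr hrn hne hle
    have hw' := mul_mem (signedSwap_mem ha hb) hw
    refine (ih _ (hk ▸ length_signedSwap_mul_lt hw ha.1 hb.1 hab hlt) hw' hle' rfl).tail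
      ((bruhat_step_iff hw').2 ⟨a, ha, b, hb, hab, ?_, ?_⟩)
    · rw [mul_inv_rev, signedSwap_inv ha.1 hb.1, Equiv.Perm.mul_apply, Equiv.Perm.mul_apply,
        signedSwap_apply_left ha.1 hb.1, signedSwap_apply_right ha.1 hb.1]
      exact hlt
    · rw [← mul_assoc, signedSwap_mul_self ha.1 hb.1, one_mul]

end Gale

/-! ### Minors on Schubert varieties -/

section Minors

lemma exists_det_submatrix_ne_zero {ι κ R : Type*} [Fintype ι] [DecidableEq ι] [Fintype κ]
    [CommRing R] {A : Matrix ι κ R} {B : Matrix κ ι R} (h : (A * B).det ≠ 0) :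
    ∃ f : ι → κ, (B.submatrix f id).det ≠ 0 := by
  have hexpand : (A * B).det =
      Matrix.detRowAlternating.toMultilinearMap fun i => ∑ a, A i a • B a := by
    change _ = Matrix.det fun i => ∑ a, A i a • B a
    congr 1
    ext i j
    rw [Matrix.mul_apply, Finset.sum_apply]
    rfl
  rw [hexpand, MultilinearMap.map_sum] at h
  obtain ⟨f, -, hf⟩ := Finset.exists_ne_zero_of_sum_ne_zero h
  rw [MultilinearMap.map_smul_univ] at hf
  exact ⟨f, right_ne_zero_of_smul hf⟩

variable {K : Type*} [Field K] {t : DynkinType} {n r : ℕ} {v w : Equiv.Perm ℤ}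

lemma entry_mul (g h : algGroup K t n) (a b : Idx t n) :
    entry (g * h) a b = ∑ c, entry g a c * entry h c b := rfl

lemma entry_one (a b : Idx t n) : entry (1 : algGroup K t n) a b = if a = b then 1 else 0 := rfl

lemma isClosed_zariski_iff {Z : Set (algGroup K t n)} :
    IsClosed[zariskiTopology K t n] Z ↔ ∃ S : Set (MvPolynomial (Idx t n × Idx t n) K),
      Z = {g | ∀ F ∈ S, MvPolynomial.eval (fun p => entry g p.1 p.2) F = 0} := by
  have hmem (S : Set (MvPolynomial (Idx t n × Idx t n) K)) (g : algGroup K t n) :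
      MvPolynomial.pointToPoint (k := K) (K := K) (fun p : Idx t n × Idx t n => entry g p.1 p.2) ∈
        PrimeSpectrum.zeroLocus S ↔
      ∀ F ∈ S, MvPolynomial.eval (fun p => entry g p.1 p.2) F = 0 :=
    (PrimeSpectrum.mem_zeroLocus _ _).trans
      (forall₂_congr fun _ _ => MvPolynomial.mem_vanishingIdeal_singleton_iff _ _)
  rw [isClosed_induced_iff]
  constructor
  · rintro ⟨Y, hY, rfl⟩
    obtain ⟨S, rfl⟩ := (PrimeSpectrum.isClosed_iff_zeroLocus _).1 hY
    exact ⟨S, Set.ext fun g => hmem S g⟩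
  · rintro ⟨S, rfl⟩
    exact ⟨_, PrimeSpectrum.isClosed_zeroLocus S, Set.ext fun g => hmem S g⟩

/-- The indices at least `r`. The corresponding basis vectors span the subspace stabilised by
`P_r`, so the minors with these columns are the Plücker coordinates of `G / P_r`. -/
abbrev UpperIdx (t : DynkinType) (n r : ℕ) : Type := {a : Idx t n // (r : ℤ) ≤ a}

lemma sum_upperIdx {M : Type*} [AddCommMonoid M] (hr : 1 ≤ r) (f : ℤ → M) :
    ∑ i : UpperIdx t n r, f (i : Idx t n) = ∑ j ∈ Finset.Icc r n, f j := by
  refine Finset.sum_bij (fun i _ => ((i : Idx t n) : ℤ).toNat) (fun i _ => ?_)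
    (fun i _ j _ h => ?_) (fun j hj => ?_) fun i _ => ?_
  · have := i.2
    have := Finset.mem_Icc.1 i.1.2.1
    rw [Finset.mem_Icc]
    omega
  · have := i.2
    have := j.2
    exact Subtype.ext (Subtype.ext (by omega))
  · rw [Finset.mem_Icc] at hj
    exact ⟨⟨⟨(j : ℤ), by rw [Finset.mem_Icc]; omega, fun _ => by omega⟩, Nat.cast_le.2 hj.1⟩,
      Finset.mem_univ _, Int.toNat_natCast j⟩
  · have := i.2
    rw [Int.toNat_of_nonneg (by omega)]

lemma upCount_values (hr : 1 ≤ r) (w : Equiv.Perm ℤ) (c : ℤ) :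
    upCount (values r n w) c = ∑ i : UpperIdx t n r, if c ≤ w (i : Idx t n) then 1 else 0 := by
  rw [upCount, sum_values, sum_upperIdx hr fun x => if c ≤ w x then (1 : ℤ) else 0]

lemma le_simpleReflection_iff {i : ℕ} (hi : 1 ≤ i) (hir : i ≠ r) (hr : 1 ≤ r) {x : ℤ} :
    (r : ℤ) ≤ simpleReflection i x ↔ (r : ℤ) ≤ x := by
  rw [simpleReflection_apply hi]
  unfold lowerEnd
  split_ifs <;> omega

lemma entry_eq_zero_of_mem_parabolic (hr : 1 ≤ r) {p : algGroup K t n}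
    (hp : p ∈ parabolic K t n r) (a b : Idx t n) (ha : (a : ℤ) < r) (hb : (r : ℤ) ≤ b) :
    entry p a b = 0 := by
  induction hp using Subgroup.closure_induction generalizing a b with
  | mem x hx =>
    by_contra h
    rcases hx with hx | ⟨i, hi, -, hir, hx⟩
    · exact ((hx a b h).trans_lt ha).not_ge hb
    · rw [(hx a b).1 h] at ha
      exact ha.not_ge ((le_simpleReflection_iff hi hir hr).2 hb)
  | one => exact if_neg (by rintro rfl; exact ha.not_ge hb)
  | mul x y _ _ hx hy =>
    rw [entry_mul]
    refine Finset.sum_eq_zero fun c _ => ?_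
    rcases lt_or_ge (c : ℤ) r with hc | hc
    · rw [hy c b hc hb, mul_zero]
    · rw [hx a c ha hc, zero_mul]
  | inv x _ hx =>
    let block (c : Idx t n) : ℕ := if (r : ℤ) ≤ c then 0 else 1
    have hblock : (x : GL (Idx t n) K).1.BlockTriangular block := by
      intro c d hcd
      refine hx c d ?_ ?_ <;> simp only [block] at hcd <;> split_ifs at hcd <;> omega
    have : Invertible (x : GL (Idx t n) K).1 := (x : GL (Idx t n) K).invertible
    have hinv := Matrix.blockTriangular_inv_of_blockTriangular hblock
    rw [← Matrix.coe_units_inv] at hinv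
    exact hinv (by simp only [block, if_pos hb, if_neg ha.not_ge, zero_lt_one])

/-- The minor of `g` with rows `f` and with the columns at least `r`. -/
def minor (f : UpperIdx t n r → Idx t n) (g : algGroup K t n) : K :=
  (Matrix.of fun i j : UpperIdx t n r => entry g (f i) j).det

lemma minor_mul (hr : 1 ≤ r) (f : UpperIdx t n r → Idx t n) (g : algGroup K t n)
    {p : algGroup K t n} (hp : p ∈ parabolic K t n r) :
    minor f (g * p) = minor f g * minor (r := r) Subtype.val p := by
  unfold minor
  rw [← Matrix.det_mul]
  congr 1
  ext i j
  rw [Matrix.mul_apply, Matrix.of_apply, entry_mul,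
    ← Fintype.sum_subtype_add_sum_subtype fun a : Idx t n => (r : ℤ) ≤ a]
  refine add_eq_left.2 (Finset.sum_eq_zero fun c _ => ?_)
  rw [entry_eq_zero_of_mem_parabolic hr hp _ _ (not_le.1 c.2) j.2, mul_zero]

lemma minor_eq_zero_of_mk_eq (hr : 1 ≤ r) (f : UpperIdx t n r → Idx t n) {g h : algGroup K t n}
    (hgh : (QuotientGroup.mk g : algGroup K t n ⧸ parabolic K t n r) = QuotientGroup.mk h)
    (hg : minor f g = 0) : minor f h = 0 := by
  rw [← mul_inv_cancel_left g h, minor_mul hr f g (QuotientGroup.eq.1 hgh), hg, zero_mul]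

lemma isClosed_minor_eq_zero (f : UpperIdx t n r → Idx t n) :
    IsClosed[zariskiTopology K t n] {g : algGroup K t n | minor f g = 0} := by
  rw [isClosed_zariski_iff]
  refine ⟨{(Matrix.of fun i j : UpperIdx t n r =>
    (MvPolynomial.X (f i, (j : Idx t n)) : MvPolynomial (Idx t n × Idx t n) K)).det}, ?_⟩
  ext g
  simp only [Set.mem_ofPred_eq, Set.mem_singleton_iff, forall_eq]
  rw [RingHom.map_det, minor]
  congr! 2
  ext i j
  simp only [Matrix.of_apply, RingHom.mapMatrix_apply, Matrix.map_apply, MvPolynomial.eval_X]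

lemma minor_eq_zero_of_mem_closure (hr : 1 ≤ r) (f : UpperIdx t n r → Idx t n)
    {Y : Set (algGroup K t n ⧸ parabolic K t n r)}
    (hY : ∀ g, QuotientGroup.mk g ∈ Y → minor f g = 0) {g : algGroup K t n}
    (hg : QuotientGroup.mk g ∈ closure[flagTopology K t n r] Y) : minor f g = 0 := by
  let _ := flagTopology K t n r
  have hclosed : IsClosed {x : algGroup K t n ⧸ parabolic K t n r |
      ∀ g, QuotientGroup.mk g = x → minor f g = 0} := by
    rw [isClosed_coinduced]
    convert isClosed_minor_eq_zero (K := K) f using 1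
    ext g
    exact ⟨fun h => h g rfl, fun h g' hg' => minor_eq_zero_of_mk_eq hr f hg'.symm h⟩
  refine closure_minimal ?_ hclosed hg g rfl
  rintro x hx g rfl
  exact hY g hx

lemma exists_minor_ne_zero (r : ℕ) (g : algGroup K t n) :
    ∃ f : UpperIdx t n r → Idx t n, minor f g ≠ 0 := by
  refine exists_det_submatrix_ne_zero (A := Matrix.of fun (i : UpperIdx t n r) a => entry g⁻¹ i a)
    (B := Matrix.of fun a (j : UpperIdx t n r) => entry g a j) ?_
  convert one_ne_zero (α := K)
  rw [← Matrix.det_one (n := UpperIdx t n r)]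
  congr 1
  ext i j
  rw [Matrix.mul_apply, Matrix.one_apply]
  refine (entry_mul g⁻¹ g i j).symm.trans ?_
  rw [inv_mul_cancel, entry_one]
  simp only [Subtype.ext_iff]

lemma exists_perm_entry_ne_zero {f : UpperIdx t n r → Idx t n} {g : algGroup K t n}
    (h : minor f g ≠ 0) :
    ∃ σ : Equiv.Perm (UpperIdx t n r), ∀ i, entry g (f (σ i)) i ≠ 0 := by
  rw [minor, Matrix.det_apply] at h
  obtain ⟨σ, -, hσ⟩ := Finset.exists_ne_zero_of_sum_ne_zero h
  refine ⟨σ, fun i hi => hσ ?_⟩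
  rw [Finset.prod_eq_zero (Finset.mem_univ i) hi, smul_zero]

lemma exists_entry_ne_zero_of_mul_representative {b h : algGroup K t n}
    (hh : h ∈ representatives K t n w) {a i : Idx t n} (hne : entry (b * h) a i ≠ 0) :
    ∃ c : Idx t n, (c : ℤ) = w i ∧ entry b a c ≠ 0 := by
  rw [entry_mul] at hne
  obtain ⟨c, -, hc⟩ := Finset.exists_ne_zero_of_sum_ne_zero hne
  exact ⟨c, (hh c i).1 (right_ne_zero_of_mul hc), left_ne_zero_of_mul hc⟩

/-- A Plücker coordinate that does not vanish somewhere on the closure of `S w P_r / P_r` does not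
vanish at some `b w`, hence neither does one of the terms of its expansion. -/
lemma exists_perm_of_mem_closure (hr : 1 ≤ r) {S : Set (algGroup K t n)} {g : algGroup K t n}
    (hg : QuotientGroup.mk g ∈ closure[flagTopology K t n r]
      {x | ∃ b ∈ S, ∃ h ∈ representatives K t n w, x = QuotientGroup.mk (b * h)})
    {f : UpperIdx t n r → Idx t n} (hf : minor f g ≠ 0) :
    ∃ b ∈ S, ∃ σ : Equiv.Perm (UpperIdx t n r), ∀ i : UpperIdx t n r, ∃ c : Idx t n,
      (c : ℤ) = w (i : Idx t n) ∧ entry b (f (σ i)) c ≠ 0 := by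
  by_contra! hno
  refine hf (minor_eq_zero_of_mem_closure hr f ?_ hg)
  rintro g' ⟨b, hb, h, hh, hg'⟩
  refine minor_eq_zero_of_mk_eq hr f hg'.symm (by_contra fun hne => ?_)
  obtain ⟨σ, hσ⟩ := exists_perm_entry_ne_zero hne
  obtain ⟨i, hi⟩ := hno b hb σ
  obtain ⟨c, hc, hbc⟩ := exists_entry_ne_zero_of_mul_representative hh (hσ i)
  exact hbc (hi c hc)

lemma upCount_le_of_mem_schubertVariety (hr : 1 ≤ r) {g : algGroup K t n}
    (hg : QuotientGroup.mk g ∈ schubertVariety K t n r w) {f : UpperIdx t n r → Idx t n}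
    (hf : minor f g ≠ 0) (c : ℤ) :
    upCount (values r n w) c ≤ ∑ i, if c ≤ (f i : ℤ) then 1 else 0 := by
  obtain ⟨b, hb, σ, hσ⟩ := exists_perm_of_mem_closure hr (S := borel K t n) hg hf
  rw [upCount_values hr, ← Equiv.sum_comp σ fun i => if c ≤ (f i : ℤ) then (1 : ℤ) else 0]
  refine Finset.sum_le_sum fun i _ => ?_
  obtain ⟨d, hd, hbd⟩ := hσ i
  have := hb _ _ hbd
  split_ifs <;> omega

lemma le_upCount_of_mem_oppSchubertVariety (hr : 1 ≤ r) {g : algGroup K t n}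
    (hg : QuotientGroup.mk g ∈ oppSchubertVariety K t n r v) {f : UpperIdx t n r → Idx t n}
    (hf : minor f g ≠ 0) (c : ℤ) :
    (∑ i, if c ≤ (f i : ℤ) then 1 else 0) ≤ upCount (values r n v) c := by
  obtain ⟨b, hb, σ, hσ⟩ := exists_perm_of_mem_closure hr (S := oppBorel K t n) hg hf
  rw [upCount_values hr, ← Equiv.sum_comp σ fun i => if c ≤ (f i : ℤ) then (1 : ℤ) else 0]
  refine Finset.sum_le_sum fun i _ => ?_
  obtain ⟨d, hd, hbd⟩ := hσ i
  have := hb _ _ hbd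
  split_ifs <;> omega

theorem galeLE_of_richardsonVariety_nonempty (hr : 1 ≤ r)
    (h : (richardsonVariety K t n r v w).Nonempty) :
    GaleLE (values r n w) (values r n v) := by
  obtain ⟨x, hxw, hxv⟩ := h
  obtain ⟨g, rfl⟩ := QuotientGroup.mk_surjective x
  obtain ⟨f, hf⟩ := exists_minor_ne_zero r g
  exact fun c => (upCount_le_of_mem_schubertVariety hr hxw hf c).trans
    (le_upCount_of_mem_oppSchubertVariety hr hxv hf c)

end Minors

/-! ### Root homomorphisms `SL₂(K) → G` -/

section RootHom

open scoped MatrixGroups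

variable {K : Type*} [Field K] {t : DynkinType} {n : ℕ}

lemma exists_sq_ne_one (K : Type*) [Field K] [Infinite K] : ∃ a : K, a ≠ 0 ∧ a ^ 2 ≠ 1 := by
  classical
  obtain ⟨a, ha⟩ := Infinite.exists_notMem_finset ({0, 1, -1} : Finset K)
  simp only [Finset.mem_insert, Finset.mem_singleton, not_or] at ha
  exact ⟨a, ha.1, by rw [ne_eq, sq_eq_one_iff]; tauto⟩

lemma monoidHom_sl2_eq_one [Infinite K] {A : Type*} [CommMonoid A] (φ : SL(2, K) →* A)
    (g : SL(2, K)) : φ g = 1 := by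
  obtain ⟨a, ha, ha'⟩ := exists_sq_ne_one K
  have hg : g ∈ commutator SL(2, K) := by
    rw [Matrix.SL2.commutator_eq_top ha ha']
    exact Subgroup.mem_top g
  have h : φ.toHomUnits g = 1 := Abelianization.commutator_subset_ker φ.toHomUnits hg
  rw [← MonoidHom.coe_toHomUnits, h, Units.val_one]

/-- The unipotent matrix `(1, c; 0, 1)`. -/
def upperUnipotent (c : K) : SL(2, K) := ⟨!![1, c; 0, 1], by simp⟩

/-- The unipotent matrix `(1, 0; c, 1)`. -/
def lowerUnipotent (c : K) : SL(2, K) := ⟨!![1, 0; c, 1], by simp⟩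

/-- The representative `(0, c; -c⁻¹, 0)` of the Weyl group element of `SL₂(K)`. -/
def weylElement (c : Kˣ) : SL(2, K) := ⟨!![0, (c : K); -(↑c⁻¹ : K), 0], by simp⟩

lemma upperUnipotent_zero : upperUnipotent (0 : K) = 1 :=
  Subtype.ext Matrix.one_fin_two.symm

lemma upperUnipotent_eq_mul (c : Kˣ) : upperUnipotent (c : K) =
    lowerUnipotent (↑c⁻¹ : K) * weylElement c * lowerUnipotent (↑c⁻¹ : K) :=
  Subtype.ext (by
    rw [Matrix.SpecialLinearGroup.coe_mul, Matrix.SpecialLinearGroup.coe_mul]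
    simp [upperUnipotent, lowerUnipotent, weylElement])

/-- The invariance of the quadratic form (type `B`) or the symplectic form (type `C`) under a
linear map: `PreservesForm` without the condition on the determinant. -/
def IsFormIsometry : (t : DynkinType) → Module.End K (Idx t n → K) → Prop
  | .B, L => ∀ x, quadForm (L x) = quadForm x
  | .C, L => ∀ x y, sympForm (L x) (L y) = sympForm x y

lemma preservesForm_toMatrixAlgEquiv' {L : Module.End K (Idx t n → K)} (hL : IsFormIsometry t L)
    (hdet : (LinearMap.toMatrixAlgEquiv' L).det = 1) :
    PreservesForm t (LinearMap.toMatrixAlgEquiv' L) := by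
  have h (x : Idx t n → K) : (LinearMap.toMatrixAlgEquiv' L).mulVec x = L x :=
    LinearMap.toMatrix'_mulVec L x
  cases t with
  | B => exact ⟨fun x => by rw [h]; exact hL x, hdet⟩
  | C => exact fun x y => by rw [h, h]; exact hL x y

/-- The homomorphism to `G` given by a representation of `SL₂(K)` that preserves the form. -/
def homOfRep [Infinite K] (ρ : Representation K SL(2, K) (Idx t n → K))
    (hρ : ∀ A, IsFormIsometry t (ρ A)) : SL(2, K) →* algGroup K t n :=
  let φ : SL(2, K) →* Matrix (Idx t n) (Idx t n) K :=
    LinearMap.toMatrixAlgEquiv'.toAlgHom.toMonoidHom.comp ρ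
  φ.toHomUnits.codRestrict (algGroup K t n) fun A =>
    preservesForm_toMatrixAlgEquiv' (hρ A) (monoidHom_sl2_eq_one (Matrix.detMonoidHom.comp φ) A)

lemma entry_homOfRep [Infinite K] (ρ : Representation K SL(2, K) (Idx t n → K))
    (hρ : ∀ A, IsFormIsometry t (ρ A)) (A : SL(2, K)) (k l : Idx t n) :
    entry (homOfRep ρ hρ A) k l = ρ A (Pi.single l 1) k :=
  LinearMap.toMatrixAlgEquiv'_apply _ _ _

/-- `φ` is the homomorphism `SL₂(K) → G` of the root of `G` whose reflection is `signedSwap a b`: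
the lower unipotent matrices go to the root subgroup that maps the line of the basis vector `a` to
the lines of `a`, …, `b`, and the Weyl element goes to a representative of the reflection. The
condition `lower` says that the conjugate of this root subgroup by a representative of `u` lies in
`B` if `u a < u b`. -/
structure IsRootHom (a b : ℤ) (φ : SL(2, K) →* algGroup K t n) : Prop where
  lower : ∀ c k l, entry (φ (lowerUnipotent c)) k l ≠ 0 →
    ∀ u ∈ weylGroup n, u a < u b → u l ≤ u k
  poly : ∀ k l, ∃ P : Polynomial K, ∀ c, entry (φ (upperUnipotent c)) k l = P.eval c
  rep : ∀ c, φ (weylElement c) ∈ representatives K t n (signedSwap a b)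

lemma isRootHom_homOfRep [Infinite K] {a b : ℤ} {ρ : Representation K SL(2, K) (Idx t n → K)}
    (hρ : ∀ A, IsFormIsometry t (ρ A))
    (lower : ∀ c k l, ρ (lowerUnipotent c) (Pi.single l 1) k ≠ 0 →
      ∀ u ∈ weylGroup n, u a < u b → u l ≤ u k)
    (poly : ∀ k l, ∃ P : Polynomial K, ∀ c,
      ρ (upperUnipotent c) (Pi.single l 1) k = P.eval c)
    (rep : ∀ c k l, ρ (weylElement c) (Pi.single l 1) k ≠ 0 ↔ (k : ℤ) = signedSwap a b l) :
    IsRootHom a b (homOfRep ρ hρ) where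
  lower := by simpa only [entry_homOfRep] using lower
  poly := by simpa only [entry_homOfRep] using poly
  rep c k l := by simpa only [entry_homOfRep] using rep c k l

/-- The index `-a`. -/
def Idx.opp (a : Idx t n) : Idx t n :=
  ⟨-a.1, by
    have := Finset.mem_Icc.1 a.2.1
    rw [Finset.mem_Icc]
    omega, fun h => neg_ne_zero.2 (a.2.2 h)⟩

@[simp] lemma Idx.coe_opp (a : Idx t n) : (a.opp : ℤ) = -a := rfl

@[simp] lemma Idx.opp_opp (a : Idx t n) : a.opp.opp = a := Subtype.ext (neg_neg _)

lemma Idx.ext_iff {a b : Idx t n} : a = b ↔ (a : ℤ) = b := Subtype.ext_iff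

lemma sum_ite_add_eq_zero (a : Idx t n) (p : Prop) [Decidable p] (f : Idx t n → K) :
    (∑ b : Idx t n, if (a : ℤ) + b = 0 ∧ p then f b else 0) = if p then f a.opp else 0 := by
  have h (b : Idx t n) : (a : ℤ) + b = 0 ↔ b = a.opp := by
    rw [Idx.ext_iff, Idx.coe_opp]
    omega
  simp only [h, ite_and, Finset.sum_ite_eq', Finset.mem_univ, if_true]

lemma quadForm_eq (x : Idx t n → K) :
    quadForm x = ∑ a : Idx t n, if 0 ≤ (a : ℤ) then x a * x a.opp else 0 :=
  Finset.sum_congr rfl fun a _ => sum_ite_add_eq_zero a _ fun b => x a * x b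

lemma sympForm_eq (x y : Idx t n → K) :
    sympForm x y = ∑ a : Idx t n, ((Int.sign (a : ℤ) : ℤ) : K) * (x a * y a.opp) :=
  Finset.sum_congr rfl fun a _ => by
    simpa using sum_ite_add_eq_zero a True fun b => ((Int.sign (a : ℤ) : ℤ) : K) * (x a * y b)

/-- The index `|a|`. -/
def Idx.abs (a : Idx t n) : Idx t n := if 0 ≤ (a : ℤ) then a else a.opp

lemma Idx.coe_abs (a : Idx t n) : (a.abs : ℤ) = (a : ℤ).natAbs := by
  rw [Idx.abs]
  split_ifs with h
  · omega
  · rw [Idx.coe_opp]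
    omega

lemma sum_nonneg_of_even {d : Idx t n → K} (hd : ∀ k, d k.opp = d k) {a b : Idx t n}
    (hab : (a : ℤ).natAbs ≠ (b : ℤ).natAbs)
    (hsupp : ∀ k : Idx t n, (k : ℤ).natAbs ≠ (a : ℤ).natAbs → (k : ℤ).natAbs ≠ (b : ℤ).natAbs →
      d k = 0) :
    (∑ k : Idx t n, if 0 ≤ (k : ℤ) then d k else 0) = d a + d b := by
  have hd' (k : Idx t n) : d k.abs = d k := by
    rw [Idx.abs]
    split_ifs
    exacts [rfl, hd k]
  have hne : a.abs ≠ b.abs := by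
    rw [ne_eq, Idx.ext_iff, Idx.coe_abs, Idx.coe_abs]
    omega
  rw [← Finset.sum_subset (Finset.subset_univ {a.abs, b.abs}), Finset.sum_pair hne,
    if_pos (by rw [Idx.coe_abs]; omega), if_pos (by rw [Idx.coe_abs]; omega), hd', hd']
  intro k _ hk
  simp only [Finset.mem_insert, Finset.mem_singleton, not_or, Idx.ext_iff, Idx.coe_abs] at hk
  split_ifs with hk0
  · exact hsupp k (by omega) (by omega)
  · rfl

lemma quadForm_congr {x y : Idx t n → K} {a b : Idx t n}
    (hab : (a : ℤ).natAbs ≠ (b : ℤ).natAbs)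
    (hother : ∀ k : Idx t n, (k : ℤ).natAbs ≠ (a : ℤ).natAbs → (k : ℤ).natAbs ≠ (b : ℤ).natAbs →
      y k = x k)
    (h : y a * y a.opp + y b * y b.opp = x a * x a.opp + x b * x b.opp) :
    quadForm y = quadForm x := by
  have hsum := sum_nonneg_of_even (d := fun k => y k * y k.opp - x k * x k.opp)
    (fun k => by rw [Idx.opp_opp]; ring) hab fun k hka hkb => by
      rw [hother k hka hkb, hother k.opp (by rwa [Idx.coe_opp, Int.natAbs_neg])
        (by rwa [Idx.coe_opp, Int.natAbs_neg]), sub_self]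
  rw [quadForm_eq, quadForm_eq, ← sub_eq_zero, ← Finset.sum_sub_distrib]
  calc ∑ k : Idx t n, ((if 0 ≤ (k : ℤ) then y k * y k.opp else 0) -
        if 0 ≤ (k : ℤ) then x k * x k.opp else 0)
      = ∑ k : Idx t n, if 0 ≤ (k : ℤ) then y k * y k.opp - x k * x k.opp else 0 :=
        Finset.sum_congr rfl fun k _ => by split_ifs <;> ring
    _ = 0 := by rw [hsum]; linear_combination h

lemma sympForm_congr {x y x' y' : Idx t n → K} {S : Finset (Idx t n)}
    (hother : ∀ k ∉ S, x' k = x k ∧ y' k.opp = y k.opp)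
    (h : ∑ k ∈ S, ((Int.sign (k : ℤ) : ℤ) : K) * (x' k * y' k.opp) =
      ∑ k ∈ S, ((Int.sign (k : ℤ) : ℤ) : K) * (x k * y k.opp)) :
    sympForm x' y' = sympForm x y := by
  rw [sympForm_eq, sympForm_eq, ← Finset.sum_add_sum_compl S, h,
    ← Finset.sum_add_sum_compl S fun k : Idx t n => ((Int.sign (k : ℤ) : ℤ) : K) * (x k * y k.opp)]
  congr 1
  refine Finset.sum_congr rfl fun k hk => ?_
  obtain ⟨h₁, h₂⟩ := hother k (Finset.mem_compl.1 hk)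
  rw [h₁, h₂]

lemma sign_coe_opp (a : Idx t n) :
    ((Int.sign (a.opp : ℤ) : ℤ) : K) = -((Int.sign (a : ℤ) : ℤ) : K) := by
  rw [Idx.coe_opp, Int.sign_neg, Int.cast_neg]

lemma sign_mul_sign {a : ℤ} (ha : a ≠ 0) : ((Int.sign a : ℤ) : K) * ((Int.sign a : ℤ) : K) = 1 := by
  rw [← Int.cast_mul, ← Int.sign_mul, Int.sign_eq_one_of_pos (mul_self_pos.2 ha), Int.cast_one]

lemma eq_signedSwap_iff {a b x y : ℤ} (ha : a ≠ 0) (hb : b ≠ 0) :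
    x = signedSwap a b y ↔ y = signedSwap a b x := by
  rw [← Equiv.Perm.inv_eq_iff_eq, signedSwap_inv ha hb, eq_comm]

section Rotation

/-- The action of `A` on the span of the basis vectors `a`, `b`, and of its adjugate transpose
(up to the sign `η` off the diagonal) on that of `-a`, `-b`. -/
def rotation (η : K) (a b : Idx t n) (A : Matrix (Fin 2) (Fin 2) K) :
    Module.End K (Idx t n → K) where
  toFun v k := if k = a then A 0 0 * v a + A 0 1 * v b
    else if k = b then A 1 0 * v a + A 1 1 * v b
    else if k = a.opp then A 1 1 * v a.opp - η * A 1 0 * v b.opp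
    else if k = b.opp then A 0 0 * v b.opp - η * A 0 1 * v a.opp else v k
  map_add' v w := by
    ext k
    simp only [Pi.add_apply]
    split_ifs <;> ring
  map_smul' c v := by
    ext k
    simp only [Pi.smul_apply, smul_eq_mul, RingHom.id_apply]
    split_ifs <;> ring

variable {η : K} {a b : Idx t n} (ha : (a : ℤ) ≠ 0) (hb : (b : ℤ) ≠ 0)
  (hab : (a : ℤ).natAbs ≠ (b : ℤ).natAbs) (A B : Matrix (Fin 2) (Fin 2) K) (v : Idx t n → K)

lemma rotation_apply (k : Idx t n) : rotation η a b A v k =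
    if k = a then A 0 0 * v a + A 0 1 * v b
    else if k = b then A 1 0 * v a + A 1 1 * v b
    else if k = a.opp then A 1 1 * v a.opp - η * A 1 0 * v b.opp
    else if k = b.opp then A 0 0 * v b.opp - η * A 0 1 * v a.opp else v k := rfl

lemma rotation_apply_left : rotation η a b A v a = A 0 0 * v a + A 0 1 * v b := if_pos rfl

include hab in
lemma rotation_apply_right : rotation η a b A v b = A 1 0 * v a + A 1 1 * v b := by
  rw [rotation_apply, if_neg, if_pos rfl]
  rw [Idx.ext_iff]
  omega

include ha hab in
lemma rotation_apply_opp_left :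
    rotation η a b A v a.opp = A 1 1 * v a.opp - η * A 1 0 * v b.opp := by
  rw [rotation_apply, if_neg, if_neg, if_pos rfl] <;> rw [Idx.ext_iff, Idx.coe_opp] <;> omega

include hb hab in
lemma rotation_apply_opp_right :
    rotation η a b A v b.opp = A 0 0 * v b.opp - η * A 0 1 * v a.opp := by
  rw [rotation_apply, if_neg, if_neg, if_neg, if_pos rfl] <;>
    simp only [Idx.ext_iff, Idx.coe_opp] <;> omega

lemma rotation_apply_of_ne {k : Idx t n} (hka : (k : ℤ).natAbs ≠ (a : ℤ).natAbs)
    (hkb : (k : ℤ).natAbs ≠ (b : ℤ).natAbs) : rotation η a b A v k = v k := by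
  rw [rotation_apply, if_neg, if_neg, if_neg, if_neg] <;>
    simp only [Idx.ext_iff, Idx.coe_opp] <;> omega

lemma rotation_one : rotation η a b 1 = 1 := by
  refine LinearMap.ext fun v => funext fun k => ?_
  rw [rotation_apply, Module.End.one_apply]
  split_ifs with h₁ h₂ h₃ h₄ <;> simp [*]

include ha hb hab in
lemma rotation_mul (hη : η * η = 1) :
    rotation η a b (A * B) = rotation η a b A * rotation η a b B := by
  refine LinearMap.ext fun v => funext fun k => ?_
  rw [Module.End.mul_apply, rotation_apply, rotation_apply _ (rotation η a b B v),
    rotation_apply_left, rotation_apply_right hab, rotation_apply_opp_left ha hab,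
    rotation_apply_opp_right hb hab]
  simp only [Matrix.mul_apply, Fin.sum_univ_two]
  split_ifs with h₁ h₂ h₃ h₄
  · ring
  · ring
  · linear_combination -(A 1 0 * B 0 1 * v a.opp) * hη
  · linear_combination -(A 0 1 * B 1 0 * v b.opp) * hη
  · rw [rotation_apply, if_neg h₁, if_neg h₂, if_neg h₃, if_neg h₄]

/-- The representation `rotation` of `SL₂(K)`. -/
def rotationRep (ha : (a : ℤ) ≠ 0) (hb : (b : ℤ) ≠ 0) (hab : (a : ℤ).natAbs ≠ (b : ℤ).natAbs)
    (hη : η * η = 1) : Representation K SL(2, K) (Idx t n → K) where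
  toFun A := rotation η a b A
  map_one' := rotation_one
  map_mul' A B := by rw [Matrix.SpecialLinearGroup.coe_mul, rotation_mul ha hb hab A B hη]

lemma isFormIsometry_rotation_B {a b : Idx .B n} (ha : (a : ℤ) ≠ 0) (hb : (b : ℤ) ≠ 0)
    (hab : (a : ℤ).natAbs ≠ (b : ℤ).natAbs) {A : Matrix (Fin 2) (Fin 2) K} (hA : A.det = 1) :
    IsFormIsometry .B (rotation 1 a b A) := by
  intro x
  refine quadForm_congr hab (fun k => rotation_apply_of_ne A x) ?_
  rw [rotation_apply_left, rotation_apply_right hab, rotation_apply_opp_left ha hab,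
    rotation_apply_opp_right hb hab]
  rw [Matrix.det_fin_two] at hA
  linear_combination (x a * x a.opp + x b * x b.opp) * hA

lemma isFormIsometry_rotation_C {a b : Idx .C n} (ha : (a : ℤ) ≠ 0) (hb : (b : ℤ) ≠ 0)
    (hab : (a : ℤ).natAbs ≠ (b : ℤ).natAbs) {A : Matrix (Fin 2) (Fin 2) K} (hA : A.det = 1) :
    IsFormIsometry .C
      (rotation (((Int.sign (a : ℤ) : ℤ) : K) * ((Int.sign (b : ℤ) : ℤ) : K)) a b A) := by
  intro x y
  have hsa := sign_mul_sign (K := K) ha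
  have hsb := sign_mul_sign (K := K) hb
  refine sympForm_congr (S := {a, b, a.opp, b.opp}) (fun k hk => ?_) ?_
  · simp only [Finset.mem_insert, Finset.mem_singleton, not_or, Idx.ext_iff, Idx.coe_opp] at hk
    refine ⟨rotation_apply_of_ne A x (by omega) (by omega), rotation_apply_of_ne A y ?_ ?_⟩ <;>
      rw [Idx.coe_opp] <;> omega
  · have hsum (f : Idx .C n → K) : ∑ k ∈ ({a, b, a.opp, b.opp} : Finset (Idx .C n)), f k =
        f a + (f b + (f a.opp + f b.opp)) := by
      rw [Finset.sum_insert, Finset.sum_insert, Finset.sum_pair] <;>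
        simp only [Finset.mem_insert, Finset.mem_singleton, ne_eq, Idx.ext_iff, Idx.coe_opp] <;>
        omega
    simp only [hsum, Idx.opp_opp, sign_coe_opp, rotation_apply_left, rotation_apply_right hab,
      rotation_apply_opp_left ha hab, rotation_apply_opp_right hb hab]
    set sa : K := ((Int.sign (a : ℤ) : ℤ) : K)
    set sb : K := ((Int.sign (b : ℤ) : ℤ) : K)
    rw [Matrix.det_fin_two] at hA
    linear_combination
      sb * (A 1 0 * x b.opp * (A 0 0 * y a + A 0 1 * y b) -
        (A 0 0 * x a + A 0 1 * x b) * A 1 0 * y b.opp) * hsa +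
      sa * (A 0 1 * x a.opp * (A 1 0 * y a + A 1 1 * y b) -
        (A 1 0 * x a + A 1 1 * x b) * A 0 1 * y a.opp) * hsb +
      (sa * (x a * y a.opp - x a.opp * y a) + sb * (x b * y b.opp - x b.opp * y b)) * hA

lemma exists_polynomial_rotation (k l : Idx t n) : ∃ P : Polynomial K, ∀ c,
    rotation η a b (upperUnipotent c) (Pi.single l 1) k = P.eval c := by
  let v : Idx t n → K := Pi.single l 1
  refine ⟨if k = a then .C (v a) + .C (v b) * .X
    else if k = b then .C (v b)
    else if k = a.opp then .C (v a.opp)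
    else if k = b.opp then .C (v b.opp) - .C η * .C (v a.opp) * .X
    else .C (v k), fun c => ?_⟩
  rw [rotation_apply]
  split_ifs <;> simp [upperUnipotent, v] <;> ring

lemma rotation_lowerUnipotent_ne_zero {c : K} {k l : Idx t n}
    (h : rotation η a b (lowerUnipotent c) (Pi.single l 1) k ≠ 0) :
    k = l ∨ (k = b ∧ l = a) ∨ (k = a.opp ∧ l = b.opp) := by
  simp only [rotation_apply, Pi.single_apply] at h
  split_ifs at h <;> simp_all [lowerUnipotent]

include ha hb in
lemma rotation_weylElement_ne_zero (hη : η ≠ 0) (c : Kˣ) (k l : Idx t n) :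
    rotation η a b (weylElement c) (Pi.single l 1) k ≠ 0 ↔ (k : ℤ) = signedSwap a b l := by
  rw [eq_signedSwap_iff ha hb, signedSwap_apply ha hb, rotation_apply]
  simp only [← Idx.coe_opp, ← Idx.ext_iff]
  split_ifs <;> simp [weylElement, hη, Pi.single_apply, Idx.ext_iff, eq_comm]

theorem exists_isRootHom_rotation [Infinite K] (ha : (a : ℤ) ≠ 0) (hb : (b : ℤ) ≠ 0)
    (hab : (a : ℤ).natAbs ≠ (b : ℤ).natAbs) (hη : η * η = 1)
    (hform : ∀ A : Matrix (Fin 2) (Fin 2) K, A.det = 1 → IsFormIsometry t (rotation η a b A)) :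
    ∃ φ : SL(2, K) →* algGroup K t n, IsRootHom a b φ := by
  have hρ (A : SL(2, K)) : IsFormIsometry t (rotationRep ha hb hab hη A) := hform A A.det_coe
  refine ⟨_, isRootHom_homOfRep hρ (fun c k l h u hu hlt => ?_) exists_polynomial_rotation
    (rotation_weylElement_ne_zero ha hb (left_ne_zero_of_mul_eq_one hη))⟩
  rcases rotation_lowerUnipotent_ne_zero h with rfl | ⟨rfl, rfl⟩ | ⟨rfl, rfl⟩
  · exact le_rfl
  · exact hlt.le
  · rw [Idx.coe_opp, Idx.coe_opp, map_neg_of_mem hu, map_neg_of_mem hu]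
    exact neg_le_neg hlt.le

end Rotation

section Plane

/-- The action of `A` on the span of the basis vectors `a`, `-a`. -/
def planeAction (a : Idx t n) (A : Matrix (Fin 2) (Fin 2) K) : Module.End K (Idx t n → K) where
  toFun v k := if k = a then A 0 0 * v a + A 0 1 * v a.opp
    else if k = a.opp then A 1 0 * v a + A 1 1 * v a.opp else v k
  map_add' v w := by
    ext k
    simp only [Pi.add_apply]
    split_ifs <;> ring
  map_smul' c v := by
    ext k
    simp only [Pi.smul_apply, smul_eq_mul, RingHom.id_apply]
    split_ifs <;> ring

lemma Idx.opp_ne {a : Idx t n} (ha : (a : ℤ) ≠ 0) : a.opp ≠ a := by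
  rw [ne_eq, Idx.ext_iff, Idx.coe_opp]
  omega

variable {a : Idx t n} (ha : (a : ℤ) ≠ 0) (A B : Matrix (Fin 2) (Fin 2) K) (v : Idx t n → K)

lemma planeAction_apply (k : Idx t n) : planeAction a A v k =
    if k = a then A 0 0 * v a + A 0 1 * v a.opp
    else if k = a.opp then A 1 0 * v a + A 1 1 * v a.opp else v k := rfl

lemma planeAction_apply_left : planeAction a A v a = A 0 0 * v a + A 0 1 * v a.opp := if_pos rfl

include ha in
lemma planeAction_apply_opp : planeAction a A v a.opp = A 1 0 * v a + A 1 1 * v a.opp := by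
  rw [planeAction_apply, if_neg (Idx.opp_ne ha), if_pos rfl]

lemma planeAction_apply_of_ne {k : Idx t n} (hk : k ≠ a) (hk' : k ≠ a.opp) :
    planeAction a A v k = v k := by
  rw [planeAction_apply, if_neg hk, if_neg hk']

lemma planeAction_one : planeAction a (1 : Matrix (Fin 2) (Fin 2) K) = 1 := by
  refine LinearMap.ext fun v => funext fun k => ?_
  rw [planeAction_apply, Module.End.one_apply]
  split_ifs with h₁ h₂ <;> simp [*]

include ha in
lemma planeAction_mul : planeAction a (A * B) = planeAction a A * planeAction a B := by
  refine LinearMap.ext fun v => funext fun k => ?_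
  rw [Module.End.mul_apply, planeAction_apply, planeAction_apply _ (planeAction a B v),
    planeAction_apply_left, planeAction_apply_opp ha]
  simp only [Matrix.mul_apply, Fin.sum_univ_two]
  split_ifs with h₁ h₂
  · ring
  · ring
  · rw [planeAction_apply_of_ne _ _ h₁ h₂]

/-- The representation `planeAction` of `SL₂(K)`. -/
def planeRep (ha : (a : ℤ) ≠ 0) : Representation K SL(2, K) (Idx t n → K) where
  toFun A := planeAction a A
  map_one' := planeAction_one
  map_mul' A B := by rw [Matrix.SpecialLinearGroup.coe_mul, planeAction_mul ha]

lemma isFormIsometry_planeAction {a : Idx .C n} (ha : (a : ℤ) ≠ 0)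
    {A : Matrix (Fin 2) (Fin 2) K} (hA : A.det = 1) : IsFormIsometry .C (planeAction a A) := by
  intro x y
  refine sympForm_congr (S := {a, a.opp}) (fun k hk => ?_) ?_
  · simp only [Finset.mem_insert, Finset.mem_singleton, not_or] at hk
    refine ⟨planeAction_apply_of_ne A x hk.1 hk.2, planeAction_apply_of_ne A y ?_ ?_⟩ <;>
      simp only [ne_eq, Idx.ext_iff, Idx.coe_opp] at hk ⊢ <;> omega
  · simp only [Finset.sum_pair (Idx.opp_ne ha).symm, Idx.opp_opp, sign_coe_opp,
      planeAction_apply_left, planeAction_apply_opp ha]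
    rw [Matrix.det_fin_two] at hA
    linear_combination ((Int.sign (a : ℤ) : ℤ) : K) * (x a * y a.opp - x a.opp * y a) * hA

lemma exists_polynomial_planeAction (k l : Idx t n) : ∃ P : Polynomial K, ∀ c,
    planeAction a (upperUnipotent c) (Pi.single l 1) k = P.eval c := by
  let v : Idx t n → K := Pi.single l 1
  refine ⟨if k = a then .C (v a) + .C (v a.opp) * .X
    else if k = a.opp then .C (v a.opp) else .C (v k), fun c => ?_⟩
  rw [planeAction_apply]
  split_ifs <;> simp [upperUnipotent, v]; ring

lemma planeAction_lowerUnipotent_ne_zero {c : K} {k l : Idx t n}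
    (h : planeAction (K := K) a (lowerUnipotent c) (Pi.single l 1) k ≠ 0) :
    k = l ∨ (k = a.opp ∧ l = a) := by
  simp only [planeAction_apply, Pi.single_apply] at h
  split_ifs at h <;> simp_all [lowerUnipotent]

include ha in
lemma planeAction_weylElement_ne_zero (c : Kˣ) (k l : Idx t n) :
    planeAction (K := K) a (weylElement c) (Pi.single l 1) k ≠ 0 ↔
      (k : ℤ) = signedSwap a (-a) l := by
  rw [eq_signedSwap_iff ha (neg_ne_zero.2 ha), signedSwap_apply ha (neg_ne_zero.2 ha),
    planeAction_apply]
  simp only [← Idx.coe_opp, ← Idx.ext_iff, Idx.opp_opp]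
  split_ifs <;> simp [weylElement, Pi.single_apply, Idx.ext_iff, eq_comm]

theorem exists_isRootHom_plane [Infinite K] {a : Idx .C n} (ha : (a : ℤ) ≠ 0) :
    ∃ φ : SL(2, K) →* algGroup K .C n, IsRootHom a (-a) φ := by
  have hρ (A : SL(2, K)) : IsFormIsometry .C (planeRep ha A) :=
    isFormIsometry_planeAction ha A.det_coe
  refine ⟨_, isRootHom_homOfRep hρ (fun c k l h u _ hlt => ?_) exists_polynomial_planeAction
    (planeAction_weylElement_ne_zero ha)⟩
  rcases planeAction_lowerUnipotent_ne_zero h with rfl | ⟨rfl, rfl⟩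
  · exact le_rfl
  · exact hlt.le

end Plane

section Adjoint

/-- The index `0` of the natural representation in type `B`. -/
def Idx.zero : Idx .B n := ⟨0, by simp, by simp⟩

@[simp] lemma Idx.coe_zero : ((Idx.zero : Idx .B n) : ℤ) = 0 := rfl

@[simp] lemma Idx.opp_zero : (Idx.zero : Idx .B n).opp = Idx.zero := rfl

/-- The action of `A` on the span of the basis vectors `a`, `0`, `-a` by the adjoint representation
of `SL₂(K)`: `x_a x_{-a} + x_0²` is minus the determinant of the traceless matrix
`(x_0, x_a; x_{-a}, -x_0)`, up to the signs of the coordinates. -/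
def adjointAction (a : Idx .B n) (A : Matrix (Fin 2) (Fin 2) K) :
    Module.End K (Idx .B n → K) where
  toFun v k :=
    if k = a then A 0 0 ^ 2 * v a - 2 * A 0 0 * A 0 1 * v .zero - A 0 1 ^ 2 * v a.opp
    else if k = a.opp then A 1 1 ^ 2 * v a.opp + 2 * A 1 0 * A 1 1 * v .zero - A 1 0 ^ 2 * v a
    else if k = .zero then
      (A 0 0 * A 1 1 + A 0 1 * A 1 0) * v .zero + A 0 1 * A 1 1 * v a.opp - A 0 0 * A 1 0 * v a
    else v k
  map_add' v w := by
    ext k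
    simp only [Pi.add_apply]
    split_ifs <;> ring
  map_smul' c v := by
    ext k
    simp only [Pi.smul_apply, smul_eq_mul, RingHom.id_apply]
    split_ifs <;> ring

variable {a : Idx .B n} (ha : (a : ℤ) ≠ 0) (A B : Matrix (Fin 2) (Fin 2) K) (v : Idx .B n → K)

lemma adjointAction_apply (k : Idx .B n) : adjointAction a A v k =
    if k = a then A 0 0 ^ 2 * v a - 2 * A 0 0 * A 0 1 * v .zero - A 0 1 ^ 2 * v a.opp
    else if k = a.opp then A 1 1 ^ 2 * v a.opp + 2 * A 1 0 * A 1 1 * v .zero - A 1 0 ^ 2 * v a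
    else if k = .zero then
      (A 0 0 * A 1 1 + A 0 1 * A 1 0) * v .zero + A 0 1 * A 1 1 * v a.opp - A 0 0 * A 1 0 * v a
    else v k := rfl

lemma adjointAction_apply_left : adjointAction a A v a =
    A 0 0 ^ 2 * v a - 2 * A 0 0 * A 0 1 * v .zero - A 0 1 ^ 2 * v a.opp := if_pos rfl

include ha in
lemma adjointAction_apply_opp : adjointAction a A v a.opp =
    A 1 1 ^ 2 * v a.opp + 2 * A 1 0 * A 1 1 * v .zero - A 1 0 ^ 2 * v a := by
  rw [adjointAction_apply, if_neg (Idx.opp_ne ha), if_pos rfl]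

include ha in
lemma adjointAction_apply_zero : adjointAction a A v .zero =
    (A 0 0 * A 1 1 + A 0 1 * A 1 0) * v .zero + A 0 1 * A 1 1 * v a.opp - A 0 0 * A 1 0 * v a := by
  rw [adjointAction_apply, if_neg, if_neg, if_pos rfl] <;>
    simp only [Idx.ext_iff, Idx.coe_opp, Idx.coe_zero] <;> omega

lemma adjointAction_apply_of_ne {k : Idx .B n} (hk : (k : ℤ).natAbs ≠ (a : ℤ).natAbs)
    (hk0 : (k : ℤ) ≠ 0) : adjointAction a A v k = v k := by
  rw [adjointAction_apply, if_neg, if_neg, if_neg] <;>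
    simp only [Idx.ext_iff, Idx.coe_opp, Idx.coe_zero] <;> omega

lemma adjointAction_one : adjointAction a (1 : Matrix (Fin 2) (Fin 2) K) = 1 := by
  refine LinearMap.ext fun v => funext fun k => ?_
  rw [adjointAction_apply, Module.End.one_apply]
  split_ifs with h₁ h₂ h₃ <;> simp [*]

include ha in
lemma adjointAction_mul :
    adjointAction a (A * B) = adjointAction a A * adjointAction a B := by
  refine LinearMap.ext fun v => funext fun k => ?_
  rw [Module.End.mul_apply, adjointAction_apply, adjointAction_apply _ (adjointAction a B v),
    adjointAction_apply_left, adjointAction_apply_opp ha, adjointAction_apply_zero ha]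
  simp only [Matrix.mul_apply, Fin.sum_univ_two]
  split_ifs with h₁ h₂ h₃
  · ring
  · ring
  · ring
  · rw [adjointAction_apply, if_neg h₁, if_neg h₂, if_neg h₃]

/-- The representation `adjointAction` of `SL₂(K)`. -/
def adjointRep (ha : (a : ℤ) ≠ 0) : Representation K SL(2, K) (Idx .B n → K) where
  toFun A := adjointAction a A
  map_one' := adjointAction_one
  map_mul' A B := by rw [Matrix.SpecialLinearGroup.coe_mul, adjointAction_mul ha]

lemma isFormIsometry_adjointAction (ha : (a : ℤ) ≠ 0) {A : Matrix (Fin 2) (Fin 2) K}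
    (hA : A.det = 1) : IsFormIsometry .B (adjointAction a A) := by
  intro x
  refine quadForm_congr (a := a) (b := .zero) (by simpa using ha)
    (fun k hka hk0 => adjointAction_apply_of_ne A x hka (by simpa using hk0)) ?_
  rw [Idx.opp_zero, adjointAction_apply_left, adjointAction_apply_opp ha,
    adjointAction_apply_zero ha]
  rw [Matrix.det_fin_two] at hA
  linear_combination (x a * x a.opp + x .zero * x .zero) *
    (A 0 0 * A 1 1 - A 0 1 * A 1 0 + 1) * hA

lemma exists_polynomial_adjointAction (k l : Idx .B n) : ∃ P : Polynomial K, ∀ c,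
    adjointAction a (upperUnipotent c) (Pi.single l 1) k = P.eval c := by
  let v : Idx .B n → K := Pi.single l 1
  refine ⟨if k = a then .C (v a) - .C (2 * v .zero) * .X - .C (v a.opp) * .X ^ 2
    else if k = a.opp then .C (v a.opp)
    else if k = .zero then .C (v .zero) + .C (v a.opp) * .X else .C (v k), fun c => ?_⟩
  rw [adjointAction_apply]
  split_ifs <;> simp [upperUnipotent, v] <;> ring

lemma adjointAction_lowerUnipotent_ne_zero {c : K} {k l : Idx .B n}
    (h : adjointAction (K := K) a (lowerUnipotent c) (Pi.single l 1) k ≠ 0) :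
    k = l ∨ ((k = a.opp ∨ k = .zero) ∧ (l = a ∨ l = .zero)) := by
  simp only [adjointAction_apply, Pi.single_apply] at h
  split_ifs at h <;> simp_all [lowerUnipotent]

include ha in
lemma adjointAction_weylElement_ne_zero (c : Kˣ) (k l : Idx .B n) :
    adjointAction (K := K) a (weylElement c) (Pi.single l 1) k ≠ 0 ↔
      (k : ℤ) = signedSwap a (-a) l := by
  rw [eq_signedSwap_iff ha (neg_ne_zero.2 ha), signedSwap_apply ha (neg_ne_zero.2 ha),
    adjointAction_apply]
  simp only [← Idx.coe_opp, ← Idx.ext_iff, Idx.opp_opp]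
  split_ifs <;> simp [weylElement, Pi.single_apply, Idx.ext_iff, eq_comm (b := (l : ℤ)), *]

theorem exists_isRootHom_adjoint [Infinite K] (ha : (a : ℤ) ≠ 0) :
    ∃ φ : SL(2, K) →* algGroup K .B n, IsRootHom a (-a) φ := by
  have hρ (A : SL(2, K)) : IsFormIsometry .B (adjointRep ha A) :=
    isFormIsometry_adjointAction ha A.det_coe
  refine ⟨_, isRootHom_homOfRep hρ (fun c k l h u hu hlt => ?_) exists_polynomial_adjointAction
    (adjointAction_weylElement_ne_zero ha)⟩
  rw [map_neg_of_mem hu] at hlt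
  rcases adjointAction_lowerUnipotent_ne_zero h with rfl | ⟨rfl | rfl, rfl | rfl⟩
  · exact le_rfl
  all_goals
    simp only [Idx.coe_opp, Idx.coe_zero, map_neg_of_mem hu, map_zero_of_mem hu]
    omega

end Adjoint

/-- The index `a`, for a nonzero integer `a` in `[-n, n]`. -/
def Idx.ofLetter (t : DynkinType) {n : ℕ} {a : ℤ} (ha : a ∈ letters n) : Idx t n :=
  ⟨a, Finset.mem_Icc.2 (mem_letters.1 ha).2, fun _ => (mem_letters.1 ha).1⟩

@[simp] lemma Idx.coe_ofLetter {a : ℤ} (ha : a ∈ letters n) : (Idx.ofLetter t ha : ℤ) = a := rfl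

theorem exists_isRootHom (K : Type*) [Field K] [Infinite K] (t : DynkinType) {n : ℕ} {a b : ℤ}
    (ha : a ∈ letters n) (hb : b ∈ letters n) (hab : a ≠ b) :
    ∃ φ : SL(2, K) →* algGroup K t n, IsRootHom a b φ := by
  have ha0 := (mem_letters.1 ha).1
  have hb0 := (mem_letters.1 hb).1
  by_cases hopp : b = -a
  · subst hopp
    cases t with
    | B => exact exists_isRootHom_adjoint (a := .ofLetter .B ha) ha0
    | C => exact exists_isRootHom_plane (a := .ofLetter .C ha) ha0
  · have hne : a.natAbs ≠ b.natAbs := by omega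
    cases t with
    | B =>
      exact exists_isRootHom_rotation (a := .ofLetter .B ha) (b := .ofLetter .B hb) ha0 hb0 hne
        (one_mul 1) fun _ hA => isFormIsometry_rotation_B ha0 hb0 hne hA
    | C =>
      exact exists_isRootHom_rotation (a := .ofLetter .C ha) (b := .ofLetter .C hb) ha0 hb0 hne
        (by rw [Idx.coe_ofLetter, Idx.coe_ofLetter, mul_mul_mul_comm, sign_mul_sign ha0,
          sign_mul_sign hb0, one_mul])
        fun _ hA => isFormIsometry_rotation_C ha0 hb0 hne hA

end RootHom

/-! ### Inclusions of Schubert varieties -/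

section Inclusion

open scoped MatrixGroups

variable {K : Type*} [Field K] {t : DynkinType} {n r : ℕ} {u v w σ : Equiv.Perm ℤ}
  {g h E : algGroup K t n}

/-- The index `w a`. -/
def Idx.act (hw : w ∈ weylGroup n) (a : Idx t n) : Idx t n :=
  ⟨w a, by
    have ha := Finset.mem_Icc.1 a.2.1
    rw [Finset.mem_Icc]
    by_cases h0 : (a : ℤ) = 0
    · rwa [h0, map_zero_of_mem hw, ← h0]
    · exact (mem_letters.1 (map_mem_letters hw (mem_letters.2 ⟨h0, ha⟩))).2,
    fun ht h0 => a.2.2 ht (w.injective (h0.trans (map_zero_of_mem hw).symm))⟩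

@[simp] lemma Idx.coe_act (hw : w ∈ weylGroup n) (a : Idx t n) : (a.act hw : ℤ) = w a := rfl

lemma entry_mul_representative (hw : w ∈ weylGroup n) (hg : g ∈ representatives K t n w)
    (h : algGroup K t n) (a b : Idx t n) :
    entry (h * g) a b = entry h a (b.act hw) * entry g (b.act hw) b := by
  rw [entry_mul, Finset.sum_eq_single_of_mem (b.act hw) (Finset.mem_univ _)]
  intro c _ hc
  rw [ne_eq, Idx.ext_iff, Idx.coe_act, ← hg c b, not_not] at hc
  rw [hc, mul_zero]

lemma entry_representative_mul (hw : w ∈ weylGroup n) (hg : g ∈ representatives K t n w)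
    (h : algGroup K t n) (a b : Idx t n) :
    entry (g * h) (a.act hw) b = entry g (a.act hw) a * entry h a b := by
  rw [entry_mul, Finset.sum_eq_single_of_mem a (Finset.mem_univ _)]
  intro c _ hc
  rw [ne_eq, eq_comm, Idx.ext_iff, ← w.injective.eq_iff, ← Idx.coe_act hw, ← hg _ c, not_not] at hc
  rw [hc, zero_mul]

lemma entry_one_ne_zero_iff {a b : Idx t n} : entry (1 : algGroup K t n) a b ≠ 0 ↔ a = b := by
  rw [entry_one, ite_ne_right_iff, and_iff_left one_ne_zero]

lemma one_mem_borel : (1 : algGroup K t n) ∈ borel K t n :=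
  fun _ _ h => (congrArg _ (entry_one_ne_zero_iff.1 h)).ge

lemma one_mem_oppBorel : (1 : algGroup K t n) ∈ oppBorel K t n :=
  fun _ _ h => (congrArg _ (entry_one_ne_zero_iff.1 h)).le

lemma mul_mem_borel (hg : g ∈ borel K t n) (hh : h ∈ borel K t n) : g * h ∈ borel K t n := by
  intro a b hab
  rw [entry_mul] at hab
  obtain ⟨c, _, hc⟩ := Finset.exists_ne_zero_of_sum_ne_zero hab
  exact (hh c b (right_ne_zero_of_mul hc)).trans (hg a c (left_ne_zero_of_mul hc))

lemma conj_mem_borel (hu : u ∈ weylGroup n) (hg : g ∈ representatives K t n u)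
    (hE : ∀ k l, entry E k l ≠ 0 → u⁻¹ l ≤ u⁻¹ k) : g⁻¹ * E * g ∈ borel K t n := by
  intro k l hkl
  have hentry : entry E (k.act hu) (l.act hu) * entry g (l.act hu) l =
      entry g (k.act hu) k * entry (g⁻¹ * E * g) k l := by
    rw [← entry_mul_representative hu hg, ← entry_representative_mul hu hg]
    congr 1
    group
  have hne : entry E (k.act hu) (l.act hu) ≠ 0 :=
    left_ne_zero_of_mul (hentry ▸ mul_ne_zero ((hg _ k).2 (Idx.coe_act hu k)) hkl)
  simpa using hE _ _ hne

lemma mul_mem_representatives (hw : w ∈ weylGroup n) (hg : g ∈ representatives K t n σ)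
    (hh : h ∈ representatives K t n w) : g * h ∈ representatives K t n (σ * w) := by
  intro a b
  rw [entry_mul_representative hw hh, mul_ne_zero_iff, hg, hh, Idx.coe_act, Equiv.Perm.mul_apply,
    and_iff_left rfl]

theorem representatives_nonempty [Infinite K] (hw : w ∈ weylGroup n) :
    (representatives K t n w).Nonempty := by
  suffices h : ∀ l, IsWord n l → (l.map simpleReflection).prod ∈ weylGroup n ∧
      (representatives K t n (l.map simpleReflection).prod).Nonempty by
    obtain ⟨l, hl, rfl⟩ := exists_word hw
    exact (h l hl).2
  intro l hl
  induction l with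
  | nil => exact ⟨one_mem _, 1, fun a b => entry_one_ne_zero_iff.trans Idx.ext_iff⟩
  | cons i l ih =>
    obtain ⟨⟨hi, hin⟩, hl⟩ := isWord_cons.1 hl
    obtain ⟨hmem, h, hh⟩ := ih hl
    obtain ⟨φ, hφ⟩ := exists_isRootHom K t (lowerEnd_mem_letters hi hin)
      (natCast_mem_letters hi hin) (lowerEnd_lt i).ne
    rw [List.map_cons, List.prod_cons]
    refine ⟨mul_mem (simpleReflection_mem hi hin) hmem, φ (weylElement 1) * h, ?_⟩
    rw [simpleReflection_eq_signedSwap]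
    exact mul_mem_representatives hmem (hφ.rep 1) hh

lemma exists_polynomial_eval {R σ : Type*} [CommRing R] (P : σ → Polynomial R)
    (F : MvPolynomial σ R) :
    ∃ Q : Polynomial R, ∀ c, MvPolynomial.eval (fun p => (P p).eval c) F = Q.eval c := by
  refine ⟨MvPolynomial.aeval P F, fun c => ?_⟩
  induction F using MvPolynomial.induction_on with
  | C a => simp
  | add p q hp hq => rw [map_add, map_add, Polynomial.eval_add, hp, hq]
  | mul_X p i hp => rw [map_mul, map_mul, Polynomial.eval_mul, hp]; simp

lemma mem_of_polynomial_curve [Infinite K] {Z : Set (algGroup K t n)}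
    (hZ : IsClosed[zariskiTopology K t n] Z) {γ : K → algGroup K t n}
    (hγ : ∀ a b, ∃ P : Polynomial K, ∀ c, entry (γ c) a b = P.eval c)
    (h : ∀ c, c ≠ 0 → γ c ∈ Z) : γ 0 ∈ Z := by
  obtain ⟨S, rfl⟩ := isClosed_zariski_iff.1 hZ
  choose P hP using hγ
  intro F hF
  obtain ⟨Q, hQ⟩ := exists_polynomial_eval (fun p : Idx t n × Idx t n => P p.1 p.2) F
  simp only [← hP] at hQ
  have hzero : Q = 0 := Q.eq_zero_of_infinite_isRoot
    ((Set.finite_singleton (0 : K)).infinite_compl.mono fun c hc =>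
      (hQ c).symm.trans (h c hc F hF))
  rw [hQ 0, hzero, Polynomial.eval_zero]

lemma IsRootHom.mk_mem_schubertVariety {a b : ℤ} {φ : SL(2, K) →* algGroup K t n}
    (hφ : IsRootHom a b φ) (hu : u ∈ weylGroup n) (hab : a < b) (hlt : u⁻¹ a < u⁻¹ b)
    (hh : h ∈ borel K t n) (hg : g ∈ representatives K t n u) (c : Kˣ) :
    QuotientGroup.mk (h * (φ (upperUnipotent c) * g)) ∈
      schubertVariety K t n r (signedSwap a b * u) := by
  set E := φ (lowerUnipotent (↑c⁻¹ : K)) with hEdef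
  have hE : E ∈ borel K t n := fun k l hkl => hφ.lower _ k l hkl 1 (one_mem _) hab
  have hconj : g⁻¹ * E * g ∈ parabolic K t n r := Subgroup.subset_closure <|
    .inl <| conj_mem_borel hu hg fun k l hkl => hφ.lower _ k l hkl u⁻¹ (inv_mem hu) hlt
  have hmul : h * (φ (upperUnipotent c) * g) =
      h * E * (φ (weylElement c) * g) * (g⁻¹ * E * g) := by
    rw [upperUnipotent_eq_mul, map_mul, map_mul, ← hEdef]
    group
  rw [hmul, QuotientGroup.mk_mul_of_mem _ hconj]
  let _ := flagTopology K t n r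
  exact subset_closure ⟨_, mul_mem_borel hh hE, _, mul_mem_representatives hu (hφ.rep c) hg, rfl⟩

lemma schubertVariety_subset_of_lt [Infinite K] (hu : u ∈ weylGroup n) {a b : ℤ}
    (ha : a ∈ letters n) (hb : b ∈ letters n) (hab : a < b) (hlt : u⁻¹ a < u⁻¹ b) :
    schubertVariety K t n r u ⊆ schubertVariety K t n r (signedSwap a b * u) := by
  obtain ⟨φ, hφ⟩ := exists_isRootHom K t ha hb hab.ne
  let _ := flagTopology K t n r
  refine closure_minimal ?_ isClosed_closure
  rintro _ ⟨h, hh, g, hg, rfl⟩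
  have hclosed : IsClosed[zariskiTopology K t n]
      ((QuotientGroup.mk : algGroup K t n → algGroup K t n ⧸ parabolic K t n r) ⁻¹'
        schubertVariety K t n r (signedSwap a b * u)) :=
    isClosed_coinduced.1 (isClosed_closure (X := algGroup K t n ⧸ parabolic K t n r))
  have hlim := mem_of_polynomial_curve hclosed
    (γ := fun c => h * (φ (upperUnipotent c) * g)) (fun k l => ?_)
    fun c hc => hφ.mk_mem_schubertVariety hu hab hlt hh hg (Units.mk0 c hc)
  · simpa only [Set.mem_preimage, upperUnipotent_zero, map_one, one_mul] using hlim
  · choose P hP using hφ.poly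
    refine ⟨∑ i, .C (entry h k i) * ∑ j, P i j * .C (entry g j l), fun c => ?_⟩
    simp only [entry_mul, hP, Polynomial.eval_finsetSum, Polynomial.eval_mul, Polynomial.eval_C]

theorem schubertVariety_subset [Infinite K] (hv : v ∈ weylGroup n) (h : BruhatLE n v w) :
    schubertVariety K t n r v ⊆ schubertVariety K t n r w := by
  suffices h : w ∈ weylGroup n ∧ schubertVariety K t n r v ⊆ schubertVariety K t n r w from h.2
  induction h with
  | refl => exact ⟨hv, subset_rfl⟩
  | tail _ hstep ih =>
    obtain ⟨hu, hsub⟩ := ih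
    obtain ⟨a, ha, b, hb, hab, hlt, rfl⟩ := (bruhat_step_iff hu).1 hstep
    exact ⟨mul_mem (signedSwap_mem ha hb) hu,
      hsub.trans (schubertVariety_subset_of_lt hu ha hb hab hlt)⟩

theorem richardsonVariety_nonempty_of_bruhatLE [Infinite K] (hv : v ∈ weylGroup n)
    (h : BruhatLE n v w) : (richardsonVariety K t n r v w).Nonempty := by
  obtain ⟨g, hg⟩ := representatives_nonempty (K := K) (t := t) hv
  let _ := flagTopology K t n r
  refine ⟨QuotientGroup.mk g, schubertVariety_subset hv h ?_, ?_⟩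
  · exact subset_closure ⟨1, one_mem_borel, g, hg, by rw [one_mul]⟩
  · exact subset_closure ⟨1, one_mem_oppBorel, g, hg, by rw [one_mul]⟩

theorem IsGrassmannian.bruhatLE_iff_galeLE (hvG : IsGrassmannian r n v) (hv : v ∈ weylGroup n)
    (hw : w ∈ weylGroup n) (hr : 1 ≤ r) (hrn : r ≤ n + 1) :
    BruhatLE n v w ↔ GaleLE (values r n w) (values r n v) :=
  ⟨fun h => galeLE_of_richardsonVariety_nonempty (K := ℚ) (t := .B) hr
    (richardsonVariety_nonempty_of_bruhatLE hv h), hvG.bruhatLE_of_galeLE hv hw hr hrn⟩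

theorem IsGrassmannian.richardsonVariety_nonempty_iff_galeLE [Infinite K]
    (hvG : IsGrassmannian r n v) (hv : v ∈ weylGroup n) (hw : w ∈ weylGroup n) (hr : 1 ≤ r)
    (hrn : r ≤ n + 1) :
    (richardsonVariety K t n r v w).Nonempty ↔ GaleLE (values r n w) (values r n v) :=
  ⟨galeLE_of_richardsonVariety_nonempty hr, fun h =>
    richardsonVariety_nonempty_of_bruhatLE hv (hvG.bruhatLE_of_galeLE hv hw hr hrn h)⟩

end Inclusion

/-! ### Weights -/

section Weights

variable {t : DynkinType} {n r i : ℕ} {a k x y : ℤ} {S : Finset ℤ} {w : Equiv.Perm ℤ}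

lemma ε_neg (k : ℤ) : ε (-k) = -ε k := by
  funext a
  simp only [ε, neg_neg, Pi.neg_apply, neg_sub]

lemma act_ε (hw : w ∈ weylGroup n) (k : ℤ) : act w (ε k) = ε (w k) := by
  funext a
  simp only [act, ε, Equiv.Perm.inv_eq_iff_eq, map_neg_of_mem hw]

lemma act_sum {ι : Type*} (s : Finset ι) (f : ι → ℤ → ℝ) (w : Equiv.Perm ℤ) :
    act w (∑ j ∈ s, f j) = ∑ j ∈ s, act w (f j) := by
  funext a
  simp only [act, Finset.sum_apply]

lemma sum_ε_apply (S : Finset ℤ) (a : ℤ) :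
    (∑ x ∈ S, ε x) a = (if a ∈ S then 1 else 0) - if -a ∈ S then 1 else 0 := by
  simp only [Finset.sum_apply, ε, Finset.sum_sub_distrib, Finset.sum_ite_eq,
    Int.eq_neg_comm (a := a), Finset.sum_ite_eq']

lemma sum_ε_pos_iff (hS : ∀ x ∈ S, -x ∉ S) : 0 < (∑ x ∈ S, ε x) a ↔ a ∈ S := by
  have := hS a
  rw [sum_ε_apply]
  split_ifs with h₁ h₂ <;> simp_all

lemma exists_act_fundamentalWeight (t : DynkinType) (r : ℕ) (hw : w ∈ weylGroup n) :
    ∃ c : ℝ, 0 < c ∧ act w (fundamentalWeight t n r) = c • ∑ x ∈ values r n w, ε x := by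
  have h : ∑ x ∈ values r n w, ε x = act w (∑ k ∈ Finset.Icc r n, ε k) := by
    rw [act_sum, sum_values]
    exact Finset.sum_congr rfl fun k _ => (act_ε hw k).symm
  cases t with
  | B => exact ⟨if r = 1 then 1 / 2 else 1, by split_ifs <;> norm_num, by rw [h]; rfl⟩
  | C => exact ⟨1, one_pos, by rw [h, one_smul]; rfl⟩

lemma mem_values_iff_act_pos (t : DynkinType) (hr : 1 ≤ r) (hw : w ∈ weylGroup n) :
    a ∈ values r n w ↔ 0 < act w (fundamentalWeight t n r) a := by
  obtain ⟨c, hc, h⟩ := exists_act_fundamentalWeight t r hw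
  rw [h, Pi.smul_apply, smul_eq_mul, mul_pos_iff_of_pos_left hc,
    sum_ε_pos_iff fun x hx => (admissible_values hr hw x hx).2]

lemma exists_smul_simpleRoot (t : DynkinType) (i : ℕ) :
    ∃ c : ℝ, 0 < c ∧ ε i - ε (lowerEnd i) = c • simpleRoot t i := by
  unfold simpleRoot lowerEnd
  by_cases h : i = 1
  · subst h
    cases t with
    | B => exact ⟨2, two_pos, by simp [ε_neg, two_smul]⟩
    | C => exact ⟨1, one_pos, by simp [ε_neg, two_smul]⟩
  · exact ⟨1, one_pos, by simp [h]⟩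

/-- The functional `x ↦ x_k + ⋯ + x_n` on weights. For `1 ≤ k` it is a nonnegative multiple of a
fundamental coweight, hence nonnegative on the simple roots. -/
def upperSum (n : ℕ) (k : ℤ) : (ℤ → ℝ) →ₗ[ℝ] ℝ := ∑ a ∈ Finset.Icc k n, LinearMap.proj a

lemma upperSum_ε (hx : x ∈ letters n) :
    upperSum n k (ε x) = (if k ≤ x then 1 else 0) - if k ≤ -x then 1 else 0 := by
  rw [mem_letters] at hx
  simp only [upperSum, LinearMap.sum_apply, LinearMap.proj_apply, ε, Finset.sum_sub_distrib,
    Finset.sum_ite_eq', Finset.mem_Icc]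
  congr 1 <;> (split_ifs <;> first | rfl | omega)

lemma upperSum_simpleRoot_nonneg (hk : 1 ≤ k) (hi : 1 ≤ i) (hin : i ≤ n) :
    0 ≤ upperSum n k (simpleRoot t i) := by
  obtain ⟨c, hc, h⟩ := exists_smul_simpleRoot t i
  refine nonneg_of_mul_nonneg_right ?_ hc
  rw [← smul_eq_mul, ← map_smul, ← h, map_sub, upperSum_ε (natCast_mem_letters hi hin),
    upperSum_ε (lowerEnd_mem_letters hi hin)]
  unfold lowerEnd
  split_ifs <;> first | omega | norm_num

lemma Nonneg.upperSum_nonneg {x : ℤ → ℝ} (h : Nonneg t n x) (hk : 1 ≤ k) : 0 ≤ upperSum n k x := by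
  obtain ⟨c, hc, rfl⟩ := h
  rw [map_sum]
  refine Finset.sum_nonneg fun i hi => ?_
  rw [Finset.mem_Icc] at hi
  rw [map_smul]
  exact mul_nonneg (hc i) (upperSum_simpleRoot_nonneg hk hi.1 hi.2)

lemma Nonneg.smul {x : ℤ → ℝ} (h : Nonneg t n x) {c : ℝ} (hc : 0 ≤ c) : Nonneg t n (c • x) := by
  obtain ⟨d, hd, rfl⟩ := h
  exact ⟨fun i => c * d i, fun i => mul_nonneg hc (hd i), by simp only [Finset.smul_sum, mul_smul]⟩

lemma le_of_nonneg_ε_sub_ε (hx : x ∈ letters n) (hy : y ∈ letters n)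
    (h : Nonneg t n (ε x - ε y)) : y ≤ x := by
  have key : ∀ k, 1 ≤ k → 0 ≤ upperSum n k (ε x) - upperSum n k (ε y) := fun k hk => by
    rw [← map_sub]
    exact h.upperSum_nonneg hk
  simp only [upperSum_ε hx, upperSum_ε hy] at key
  have := hx.1
  by_contra hlt
  rcases lt_or_gt_of_ne hy.1 with hy0 | hy0
  · have := key (-x) (by omega)
    split_ifs at this <;> first | omega | norm_num at this
  · have := key y hy0
    split_ifs at this <;> first | omega | norm_num at this

lemma isGrassmannian_of_mem_minimalReps (hw : w ∈ minimalReps t n r) : IsGrassmannian r n w := by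
  intro i hi hin hir
  obtain ⟨c, hc, hroot⟩ := exists_smul_simpleRoot t i
  have hnonneg : Nonneg t n (ε (w i) - ε (w (lowerEnd i))) := by
    rw [← act_ε hw.1, ← act_ε hw.1]
    change Nonneg t n (act w (ε i - ε (lowerEnd i)))
    rw [hroot]
    exact (hw.2 i hi hin hir).2.smul hc.le
  exact (le_of_nonneg_ε_sub_ε (map_mem_letters hw.1 (natCast_mem_letters hi hin))
    (map_mem_letters hw.1 (lowerEnd_mem_letters hi hin)) hnonneg).lt_of_ne
    fun h => (lowerEnd_lt i).ne (w.injective h)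

end Weights

/-! ### Sums of orthogonal simple roots -/

section RootSums

variable {t : DynkinType} {n r e m s : ℕ} {c : ℤ} {i j : Fin m → ℕ} {v w : Equiv.Perm ℤ}

lemma oddPart_eq (t : DynkinType) : oddPart t = ε 1 := by
  cases t with
  | B => simp [oddPart, simpleRoot]
  | C => simp [oddPart, simpleRoot, smul_smul]

lemma simpleRoot_of_two_le (t : DynkinType) {i : ℕ} (hi : 2 ≤ i) :
    simpleRoot t i = ε i + ε (-((i : ℤ) - 1)) := by
  unfold simpleRoot
  rw [if_neg (by omega), ε_neg, sub_eq_add_neg]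

lemma add_two_le_of_mem_J (hi : i ∈ J m s n) {k l : Fin m} (h : k < l) : i k + 2 ≤ i l := by
  have key : ∀ d : ℕ, ∀ k l : Fin m, (l : ℕ) = k + d + 1 → i k + 2 ≤ i l := by
    intro d
    induction d with
    | zero => exact hi.2
    | succ d ih =>
      intro k l h
      have hd : (k : ℕ) + d + 1 < m := by omega
      have h₁ := ih k ⟨_, hd⟩ rfl
      have h₂ := hi.2 ⟨_, hd⟩ l h
      omega
  exact key (l - k - 1) k l (by have : (k : ℕ) < l := h; omega)

lemma monotone_of_mem_J (hi : i ∈ J m s n) : Monotone i :=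
  StrictMono.monotone fun _ _ h => (Nat.lt_add_of_pos_right two_pos).trans_le
    (add_two_le_of_mem_J hi h)

/-- The letters `x` for which `ε x` occurs in the weight `e • oddPart t + ∑ k, simpleRoot t (i k)`,
with multiplicity. -/
def rootLetters (e : ℕ) (i : Fin m → ℕ) : Fin m ⊕ (Fin m ⊕ Fin e) → ℤ :=
  Sum.elim (fun k => i k) (Sum.elim (fun k => -((i k : ℤ) - 1)) fun _ => 1)

lemma sum_ε_rootLetters (t : DynkinType) (hi : i ∈ J m (2 + e) n) :
    ∑ x, ε (rootLetters e i x) = e • oddPart t + ∑ k, simpleRoot t (i k) := by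
  have h : ∀ k, simpleRoot t (i k) = ε (i k) + ε (-((i k : ℤ) - 1)) := fun k =>
    simpleRoot_of_two_le t (by have := (hi.1 k).1; omega)
  simp only [rootLetters, Fintype.sum_sum_type, Sum.elim_inl, Sum.elim_inr, h, oddPart_eq,
    Finset.sum_add_distrib, Finset.sum_const, Finset.card_univ, Fintype.card_fin]
  abel

lemma rootLetters_ne_zero (hi : i ∈ J m (2 + e) n) (x : Fin m ⊕ (Fin m ⊕ Fin e)) :
    rootLetters e i x ≠ 0 := by
  rcases x with k | k | _
  · have := (hi.1 k).1
    simp only [rootLetters, Sum.elim_inl]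
    omega
  · have := (hi.1 k).1
    simp only [rootLetters, Sum.elim_inl, Sum.elim_inr]
    omega
  · exact one_ne_zero

lemma natAbs_rootLetters_injective (he : e ≤ 1) (hi : i ∈ J m (2 + e) n) :
    Function.Injective fun x => (rootLetters e i x).natAbs := by
  have hsep : ∀ k l, k = l ∨ i k + 2 ≤ i l ∨ i l + 2 ≤ i k := fun k l => by
    rcases lt_trichotomy k l with h | h | h
    exacts [.inr (.inl (add_two_le_of_mem_J hi h)), .inl h, .inr (.inr (add_two_le_of_mem_J hi h))]
  have hlow := fun k => (hi.1 k).1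
  have hlt := fun k : Fin e => k.2
  rintro (k | k | k) (l | l | l) h <;>
    simp only [rootLetters, Sum.elim_inl, Sum.elim_inr, Sum.inl.injEq, Sum.inr.injEq,
      reduceCtorEq] at h ⊢
  case inr.inr.inr.inr => exact Fin.ext (by have := hlt k; have := hlt l; omega)
  case inl.inr.inr => have := hlow k; have := hlt l; omega
  case inr.inl.inr.inr => have := hlow k; have := hlt l; omega
  case inr.inr.inl => have := hlow l; have := hlt k; omega
  case inr.inr.inr.inl => have := hlow l; have := hlt k; omega
  all_goals
    have := hlow k
    have := hlow l
    rcases hsep k l with rfl | _ <;> first | rfl | omega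

lemma values_eq_image {ι : Type*} [Fintype ι] (hr : 1 ≤ r) (hw : w ∈ weylGroup n) {f : ι → ℤ}
    (hf : Function.Injective fun x => (f x).natAbs) (hf0 : ∀ x, f x ≠ 0)
    (h : act w (fundamentalWeight t n r) = ∑ x, ε (f x)) :
    values r n w = Finset.univ.image f := by
  have hinj : Function.Injective f := .of_comp (f := Int.natAbs) hf
  ext a
  rw [mem_values_iff_act_pos t hr hw, h, ← Finset.sum_image (g := f) hinj.injOn, sum_ε_pos_iff]
  simp only [Finset.mem_image, Finset.mem_univ, true_and]
  rintro _ ⟨x, rfl⟩ ⟨y, hy⟩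
  obtain rfl : y = x := hf (by simp only [hy, Int.natAbs_neg])
  exact hf0 y (by omega)

lemma upCount_values_of_act_eq {ι : Type*} [Fintype ι] (hr : 1 ≤ r) (hw : w ∈ weylGroup n)
    {f : ι → ℤ} (hf : Function.Injective fun x => (f x).natAbs) (hf0 : ∀ x, f x ≠ 0)
    (h : act w (fundamentalWeight t n r) = ∑ x, ε (f x)) (c : ℤ) :
    upCount (values r n w) c = ∑ x, if c ≤ f x then 1 else 0 := by
  have hinj : Function.Injective f := .of_comp (f := Int.natAbs) hf
  rw [values_eq_image hr hw hf hf0 h, upCount, Finset.sum_image hinj.injOn]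

lemma sum_ite_lt_sum_ite {ι : Type*} [Fintype ι] {f g : ι → ℤ} {k : ι}
    (h : ∀ l, f l ≤ f k ∨ g k ≤ g l) (hk : f k < g k) :
    (∑ l, if g k ≤ f l then (1 : ℤ) else 0) < ∑ l, if g k ≤ g l then 1 else 0 := by
  refine Finset.sum_lt_sum (fun l _ => ?_) ⟨k, Finset.mem_univ k, ?_⟩
  · have := h l
    split_ifs <;> omega
  · rw [if_neg hk.not_ge, if_pos le_rfl]
    exact one_pos

lemma sum_ite_le_neg {ι : Type*} (S : Finset ι) (f : ι → ℤ) (c : ℤ) :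
    (∑ x ∈ S, if c ≤ -f x then (1 : ℤ) else 0) =
      S.card - ∑ x ∈ S, if 1 - c ≤ f x then 1 else 0 := by
  rw [Finset.cast_card, ← Finset.sum_sub_distrib]
  refine Finset.sum_congr rfl fun x _ => ?_
  split_ifs <;> omega

lemma sum_ite_neg_rootLetters_le_symm
    (h : ∀ c, (∑ x, if c ≤ -rootLetters e j x then (1 : ℤ) else 0) ≤
      ∑ x, if c ≤ rootLetters e i x then 1 else 0) (c : ℤ) :
    (∑ x, if c ≤ -rootLetters e i x then (1 : ℤ) else 0) ≤
      ∑ x, if c ≤ rootLetters e j x then 1 else 0 := by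
  have := h (1 - c)
  rw [sum_ite_le_neg, sub_sub_cancel] at this
  rw [sum_ite_le_neg]
  omega

lemma sum_ite_le_rootLetters (hi : i ∈ J m (2 + e) n) (hc : (e : ℤ) < c) :
    (∑ x, if c ≤ rootLetters e i x then (1 : ℤ) else 0) = ∑ k, if c ≤ i k then 1 else 0 := by
  have hlow : ∀ x, ¬c ≤ rootLetters e i (.inr x) := by
    rintro (k | k)
    · have := (hi.1 k).1
      simp only [rootLetters, Sum.elim_inl, Sum.elim_inr]
      omega
    · have := k.2
      simp only [rootLetters, Sum.elim_inr]
      omega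
  rw [Fintype.sum_sum_type, Finset.sum_eq_zero fun x _ => if_neg (hlow x), add_zero]
  rfl

lemma sum_ite_le_neg_rootLetters (e : ℕ) (j : Fin m → ℕ) (c : ℤ) :
    (∑ k, if c ≤ (j k : ℤ) - 1 then (1 : ℤ) else 0) ≤
      ∑ x, if c ≤ -rootLetters e j x then 1 else 0 := by
  simp only [Fintype.sum_sum_type, rootLetters, Sum.elim_inl, Sum.elim_inr, neg_neg]
  rw [add_left_comm]
  exact le_add_of_nonneg_right (by positivity)

lemma le_add_one_of_sum_rootLetters_le (hi : i ∈ J m (2 + e) n) (hj : j ∈ J m (2 + e) n)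
    (h : ∀ c, (∑ x, if c ≤ -rootLetters e j x then (1 : ℤ) else 0) ≤
      ∑ x, if c ≤ rootLetters e i x then 1 else 0) (k : Fin m) : j k ≤ i k + 1 := by
  by_contra! hlt
  refine ((sum_ite_le_neg_rootLetters e j (j k - 1)).trans (h _)).not_gt ?_
  rw [sum_ite_le_rootLetters hi (by have := (hj.1 k).1; omega)]
  refine sum_ite_lt_sum_ite (f := fun l => (i l : ℤ)) (g := fun l => (j l : ℤ) - 1) (fun l => ?_)
    (by omega)
  rcases le_total l k with hl | hl
  · exact .inl (Nat.cast_le.2 (monotone_of_mem_J hi hl))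
  · exact .inr (sub_le_sub_right (Nat.cast_le.2 (monotone_of_mem_J hj hl)) 1)

lemma sum_rootLetters_le_iff (hi : i ∈ J m (2 + e) n) (hj : j ∈ J m (2 + e) n) :
    (∀ c, (∑ x, if c ≤ -rootLetters e j x then (1 : ℤ) else 0) ≤
      ∑ x, if c ≤ rootLetters e i x then 1 else 0) ↔ ∀ k, |(i k : ℤ) - j k| ≤ 1 := by
  refine ⟨fun h k => ?_, fun h c => ?_⟩
  · have h₁ := le_add_one_of_sum_rootLetters_le hi hj h k
    have h₂ := le_add_one_of_sum_rootLetters_le hj hi (sum_ite_neg_rootLetters_le_symm h) k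
    rw [abs_le]
    omega
  · simp only [abs_le] at h
    simp only [Fintype.sum_sum_type, rootLetters, Sum.elim_inl, Sum.elim_inr]
    rw [add_left_comm]
    refine add_le_add (Finset.sum_le_sum fun k _ => ?_) (add_le_add
      (Finset.sum_le_sum fun k _ => ?_) (Finset.sum_le_sum fun k _ => ?_))
    · have := h k
      split_ifs <;> omega
    · have := h k
      split_ifs <;> omega
    · split_ifs <;> omega

theorem galeLE_values_iff (hr : 1 ≤ r) (he : e ≤ 1) (hi : i ∈ J m (2 + e) n)
    (hj : j ∈ J m (2 + e) n) (hv : v ∈ weylGroup n) (hw : w ∈ weylGroup n)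
    (hvω : act v (fundamentalWeight t n r) = e • oddPart t + ∑ k, simpleRoot t (i k))
    (hwω : act w (fundamentalWeight t n r) = -(e • oddPart t + ∑ k, simpleRoot t (j k))) :
    GaleLE (values r n w) (values r n v) ↔ ∀ k, |(i k : ℤ) - j k| ≤ 1 := by
  rw [← sum_ε_rootLetters t hi] at hvω
  rw [← sum_ε_rootLetters t hj, ← Finset.sum_neg_distrib] at hwω
  simp only [← ε_neg] at hwω
  rw [← sum_rootLetters_le_iff hi hj]
  refine forall_congr' fun c => ?_
  rw [upCount_values_of_act_eq hr hv (natAbs_rootLetters_injective he hi) (rootLetters_ne_zero hi)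
    hvω, upCount_values_of_act_eq hr hw
    (by simpa only [Int.natAbs_neg] using natAbs_rootLetters_injective he hj)
    (fun x => neg_ne_zero.2 (rootLetters_ne_zero hj x)) hwω]

end RootSums

/-! ### The extremal fundamental weights -/

section Extremal

variable {t : DynkinType} {n r : ℕ} {k : ℤ} {v w : Equiv.Perm ℤ}

lemma upperSum_sum_ε (hr : 1 ≤ r) (hw : w ∈ weylGroup n) (k : ℤ) :
    upperSum n k (∑ x ∈ values r n w, ε x) =
      ((upCount (values r n w) k + upCount (values r n w) (1 - k) -
        (values r n w).card : ℤ) : ℝ) := by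
  have h : upCount (values r n w) k + upCount (values r n w) (1 - k) - (values r n w).card =
      ∑ x ∈ values r n w, ((if k ≤ x then 1 else 0) - if k ≤ -x then 1 else 0) := by
    rw [Finset.sum_sub_distrib, sum_ite_le_neg _ fun x => x, sub_sub_eq_add_sub]
    rfl
  rw [map_sum, h, Int.cast_sum]
  refine Finset.sum_congr rfl fun x hx => ?_
  rw [upperSum_ε (admissible_values hr hw x hx).1]
  push_cast
  rfl

lemma card_le_upCount_add_upCount (hr : 1 ≤ r) (hv : v ∈ weylGroup n)
    (h : Nonneg t n (act v (fundamentalWeight t n r))) (hk : 1 ≤ k) :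
    ((values r n v).card : ℤ) ≤ upCount (values r n v) k + upCount (values r n v) (1 - k) := by
  obtain ⟨c, hc, hact⟩ := exists_act_fundamentalWeight t r hv
  have hsum := h.upperSum_nonneg hk
  rw [hact, map_smul, smul_eq_mul, mul_nonneg_iff_of_pos_left hc, upperSum_sum_ε hr hv] at hsum
  exact sub_nonneg.1 (Int.cast_nonneg_iff.1 hsum)

lemma upCount_add_upCount_le_card (hr : 1 ≤ r) (hw : w ∈ weylGroup n)
    (h : Nonneg t n (-act w (fundamentalWeight t n r))) (hk : 1 ≤ k) :
    upCount (values r n w) k + upCount (values r n w) (1 - k) ≤ (values r n w).card := by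
  obtain ⟨c, hc, hact⟩ := exists_act_fundamentalWeight t r hw
  have hsum := h.upperSum_nonneg hk
  rw [hact, ← smul_neg, map_smul, smul_eq_mul, mul_nonneg_iff_of_pos_left hc, map_neg,
    neg_nonneg, upperSum_sum_ε hr hw] at hsum
  exact sub_nonpos.1 (Int.cast_nonpos.1 hsum)

lemma natAbs_map_natAbs (hw : w ∈ weylGroup n) (x : ℤ) : (w x.natAbs).natAbs = (w x).natAbs := by
  rcases Int.natAbs_eq x with h | h
  · rw [← h]
  · rw [← Int.natAbs_neg, ← map_neg_of_mem hw, ← h]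

lemma natAbs_map_mem_Icc (hw : w ∈ weylGroup n) {a : ℕ} (ha : a ∈ Finset.Icc 1 n) :
    (w a).natAbs ∈ Finset.Icc 1 n := by
  rw [Finset.mem_Icc] at ha ⊢
  have := mem_letters.1 (map_mem_letters hw (natCast_mem_letters ha.1 ha.2))
  omega

lemma sum_values_of_even (hw : w ∈ weylGroup n) {f : ℤ → ℤ} (hf : ∀ x, f (-x) = f x) :
    ∑ x ∈ values 1 n w, f x = ∑ a ∈ Finset.Icc 1 n, f a := by
  rw [sum_values]
  refine Finset.sum_nbij' (fun a => (w a).natAbs) (fun a => (w⁻¹ a).natAbs)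
    (fun a => natAbs_map_mem_Icc hw) (fun a => natAbs_map_mem_Icc (inv_mem hw))
    (fun a _ => ?_) (fun a _ => ?_) fun a _ => ?_
  · rw [natAbs_map_natAbs (inv_mem hw), Equiv.Perm.coe_inv, Equiv.symm_apply_apply,
      Int.natAbs_natCast]
  · rw [natAbs_map_natAbs hw, Equiv.Perm.coe_inv, Equiv.apply_symm_apply, Int.natAbs_natCast]
  · rcases Int.natAbs_eq (w a) with h | h
    · rw [← h]
    · rw [h, hf, Int.natAbs_neg, Int.natAbs_natCast]

lemma upCount_sub_upCount_values_one (hw : w ∈ weylGroup n) (k : ℤ) :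
    upCount (values 1 n w) k - upCount (values 1 n w) (1 - k) =
      ∑ a ∈ Finset.Icc 1 n,
        ((if k ≤ (a : ℤ) then 1 else 0) - if 1 - k ≤ (a : ℤ) then 1 else 0) := by
  rw [upCount, upCount, ← Finset.sum_sub_distrib]
  refine sum_values_of_even hw fun x => ?_
  split_ifs <;> omega

lemma GaleLE.of_forall_pos {A C : Finset ℤ}
    (h : ∀ k, 1 ≤ k → upCount C k ≤ upCount A k ∧ upCount C (1 - k) ≤ upCount A (1 - k)) :
    GaleLE C A := fun c => by
  rcases le_or_gt 1 c with hc | hc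
  · exact (h c hc).1
  · simpa only [sub_sub_cancel] using (h (1 - c) (by omega)).2

theorem galeLE_of_nonneg_of_nonpos (hn : 1 ≤ n) (hr : r = 1 ∨ r = n) (hv : v ∈ weylGroup n)
    (hw : w ∈ weylGroup n) (hvω : Nonneg t n (act v (fundamentalWeight t n r)))
    (hwω : Nonneg t n (-act w (fundamentalWeight t n r))) :
    GaleLE (values r n w) (values r n v) := by
  have hr1 : 1 ≤ r := by omega
  refine .of_forall_pos fun k hk => ?_
  have hle := upCount_add_upCount_le_card hr1 hw hwω hk
  have hge := card_le_upCount_add_upCount hr1 hv hvω hk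
  rw [card_values] at hle hge
  rcases hr with rfl | rfl
  · have hsub := (upCount_sub_upCount_values_one hv k).trans
      (upCount_sub_upCount_values_one hw k).symm
    omega
  · simp only [upCount, values, Finset.Icc_self, Finset.image_singleton,
      Finset.sum_singleton, Finset.card_singleton] at *
    split_ifs at * <;> omega

end Extremal

end RichardsonBC

end

theorem proposition4p4_general (K : Type*) [Field K] [Infinite K] (t : DynkinType) (n r : ℕ) :
    (1 ≤ r → r ≤ n → ∀ m : ℕ, ∀ i ∈ J m 2 n, ∀ j ∈ J m 2 n,
      ∀ v ∈ minimalReps t n r, ∀ w ∈ weylGroup n,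
        act v (fundamentalWeight t n r) = ∑ k, simpleRoot t (i k) →
        act w (fundamentalWeight t n r) = -∑ k, simpleRoot t (j k) →
        ((richardsonVariety K t n r v w).Nonempty ↔ ∀ k, |(i k : ℤ) - (j k : ℤ)| ≤ 1) ∧
        (BruhatLE n v w ↔ ∀ k, |(i k : ℤ) - (j k : ℤ)| ≤ 1)) ∧
    (1 ≤ r → r ≤ n → ∀ m : ℕ, ∀ i ∈ J m 3 n, ∀ j ∈ J m 3 n,
      ∀ v ∈ minimalReps t n r, ∀ w ∈ weylGroup n,
        act v (fundamentalWeight t n r) = oddPart t + ∑ k, simpleRoot t (i k) →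
        act w (fundamentalWeight t n r) = -(oddPart t + ∑ k, simpleRoot t (j k)) →
        ((richardsonVariety K t n r v w).Nonempty ↔ ∀ k, |(i k : ℤ) - (j k : ℤ)| ≤ 1) ∧
        (BruhatLE n v w ↔ ∀ k, |(i k : ℤ) - (j k : ℤ)| ≤ 1)) ∧
    (1 ≤ n → r = 1 ∨ r = n → ∀ v ∈ minimalReps t n r, ∀ w ∈ weylGroup n,
      Nonneg t n (act v (fundamentalWeight t n r)) →
      Nonneg t n (-act w (fundamentalWeight t n r)) →
        (richardsonVariety K t n r v w).Nonempty ∧ BruhatLE n v w) := by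
  have hiff : 1 ≤ r → r ≤ n → ∀ v ∈ minimalReps t n r, ∀ w ∈ weylGroup n,
      ((richardsonVariety K t n r v w).Nonempty ↔ GaleLE (values r n w) (values r n v)) ∧
      (BruhatLE n v w ↔ GaleLE (values r n w) (values r n v)) := fun hr hrn v hv w hw =>
    have hvG := isGrassmannian_of_mem_minimalReps hv
    ⟨hvG.richardsonVariety_nonempty_iff_galeLE hv.1 hw hr (by omega),
      hvG.bruhatLE_iff_galeLE hv.1 hw hr (by omega)⟩
  refine ⟨fun hr hrn m i hi j hj v hv w hw hvω hwω => ?_,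
    fun hr hrn m i hi j hj v hv w hw hvω hwω => ?_, fun hn hr v hv w hw hvω hwω => ?_⟩
  · rw [← galeLE_values_iff (e := 0) hr zero_le_one hi hj hv.1 hw (by simpa using hvω)
      (by simpa using hwω)]
    exact hiff hr hrn v hv w hw
  · rw [← galeLE_values_iff (e := 1) hr le_rfl hi hj hv.1 hw (by simpa using hvω)
      (by simpa using hwω)]
    exact hiff hr hrn v hv w hw
  · have hle := galeLE_of_nonneg_of_nonpos hn hr hv.1 hw hvω hwω
    exact (hiff (by omega) (by omega) v hv w hw).imp (·.2 hle) (·.2 hle)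

theorem proposition4p4 (K : Type*) [Field K] [IsAlgClosed K] (t : DynkinType) (n r : ℕ) :
    -- `2 ≤ r ≤ n - 1` and `n + 1 - r = 2m` is even
    (2 ≤ r → r + 1 ≤ n → ∀ m : ℕ, n + 1 = r + 2 * m →
      ∀ i ∈ J m 2 n, ∀ j ∈ J m 2 n,
      ∀ v ∈ minimalReps t n r, ∀ w ∈ minimalReps t n r,
        act v (fundamentalWeight t n r) = ∑ k, simpleRoot t (i k) →
        act w (fundamentalWeight t n r) = -∑ k, simpleRoot t (j k) →
        ((richardsonVariety K t n r v w).Nonempty ↔ ∀ k, |(i k : ℤ) - (j k : ℤ)| ≤ 1) ∧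
        (BruhatLE n v w ↔ ∀ k, |(i k : ℤ) - (j k : ℤ)| ≤ 1)) ∧
    -- `2 ≤ r ≤ n - 1` and `n + 1 - r = 2m + 1` is odd
    (2 ≤ r → r + 1 ≤ n → ∀ m : ℕ, n + 1 = r + (2 * m + 1) →
      ∀ i ∈ J m 3 n, ∀ j ∈ J m 3 n,
      ∀ v ∈ minimalReps t n r, ∀ w ∈ minimalReps t n r,
        act v (fundamentalWeight t n r) = oddPart t + ∑ k, simpleRoot t (i k) →
        act w (fundamentalWeight t n r) = -(oddPart t + ∑ k, simpleRoot t (j k)) →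
        ((richardsonVariety K t n r v w).Nonempty ↔ ∀ k, |(i k : ℤ) - (j k : ℤ)| ≤ 1) ∧
        (BruhatLE n v w ↔ ∀ k, |(i k : ℤ) - (j k : ℤ)| ≤ 1)) ∧
    -- `r = 1` or `r = n`
    (1 ≤ n → r = 1 ∨ r = n →
      ∀ v w : Equiv.Perm ℤ, IsMaximalNonneg t n r v → IsMinimalNonpos t n r w →
        (richardsonVariety K t n r v w).Nonempty ∧ BruhatLE n v w) := by
  obtain ⟨heven, hodd, hextremal⟩ := proposition4p4_general K t n r
  exact ⟨fun hr hrn m _ i hi j hj v hv w hw => heven (by omega) (by omega) m i hi j hj v hv w hw.1,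
    fun hr hrn m _ i hi j hj v hv w hw => hodd (by omega) (by omega) m i hi j hj v hv w hw.1,
    fun hn hr v w hv hw => hextremal hn hr v hv.1 w hw.1.1 hv.2.1 hw.2.1⟩
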